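/- Let $S^2\subset\mathbb R^3$ be the round unit sphere with its induced Riemannian metric and let $\mu$ be its area measure, normalized to be a probability measure. Let $PS^2$ be the projective bundle of $S^2$, whose points are the lines in the tangent planes $T_xS^2$, and let $m$ be the normalized Liouville measure on $PS^2$, i.e. the probability measure that projects to $\mu$ on $S^2$ and whose conditional measure on each fibre $P_xS^2$ is the uniform one. For a Borel probability measure $\nu$ on the group $\mathrm{Diff}^1(S^2)$ of $C^1$ diffeomorphisms (with the $C^1$ topology), the random exponent $R(\nu)$ is defined as follows. For an independent, $\nu$-distributed sequence $h=(h_i)_{i\ge1}$ put $h^{(n)}=h_n\circ\cdots\circ h_1$. If for $\nu^{\infty}$-almost every $h$ the limit $$R(x,h,\nu)=\lim_{n\to\infty}\frac1n\log\|T_xh^{(n)}\|$$ exists for $\mu$-almost every $x\in S^2$, is $\mu$-integrable in $x$, and $\int_{S^2}R(x,h,\nu)\,d\mu(x)$ has the same value for almost every $h$, then $R(\nu)$ is this value. Let $f$ be a $C^1$ diffeomorphism of $S^2$ that preserves $\mu$, and let $\nu$ be the push-forward of the Haar probability measure of $SO(3)$ under $g\mapsto g\circ f$, a measure on $\{g\circ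 f \mid g\in SO(3)\}$. Then the random exponent $R(\nu)$ exists, the function $v\mapsto\log\|Tf\,v\|$ (evaluated at a unit vector $v$ spanning the given line) is $m$-integrable, and $$R(\nu)=\int_{PS^2}\log\|Tf\,v\|\,dm(v).$$ Moreover, $R(\nu)>0$ unless $f$ is an isometry of $S^2$. -/

import Mathlib

open MeasureTheory Filter Set
open scoped Manifold ContDiff RealInnerProductSpace Topology

noncomputable section

namespace RandomSphere

/-! ### The round sphere and its normalized area -/

/-- Euclidean three-space. -/
abbrev E3 : Type := EuclideanSpace ℝ (Fin 3)

/-- The round sphere `S²`, as the unit sphere of `ℝ³`, with Mathlib's manifold structure. -/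
abbrev S2 : Type := Metric.sphere (0 : E3) 1

instance factFinrankE3 : Fact (Module.finrank ℝ E3 = 2 + 1) :=
  ⟨finrank_euclideanSpace_fin⟩

/-- Lebesgue measure (area) on `S²`, normalized to be a probability measure. -/
def area : Measure S2 := ProbabilityTheory.cond (volume : Measure E3).toSphere univ

/-- `C¹` diffeomorphisms of `S²`. -/
abbrev SphereDiffeo : Type := S2 ≃ₘ^1⟮𝓡 2, 𝓡 2⟯ S2

/-! ### Tangent maps

The tangent space at `x` is identified with the plane `x^⊥` in `ℝ³` by the differential of the
inclusion; the Riemannian norm is then the norm of `ℝ³`. -/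

/-- The differential at `x` of the inclusion of `S²` in `ℝ³`, as an isomorphism of the tangent
space at `x` with the plane orthogonal to `x`. -/
def tangentIso (x : S2) : TangentSpace (𝓡 2) x ≃ₗ[ℝ] (ℝ ∙ (x : E3))ᗮ :=
  (LinearEquiv.ofInjective (mvfderiv (𝓡 2) ((↑) : S2 → E3) x).toLinearMap
    (injective_mvfderiv_subtypeVal_sphere x)).trans
    (LinearEquiv.ofEq _ _ (range_mvfderiv_subtypeVal x))

/-- The tangent map `T_x F : T_x S² → T_{F x} S²`, tangent spaces being seen as planes in `ℝ³`. -/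
def sphereDeriv (F : S2 → S2) (x : S2) :
    (ℝ ∙ (x : E3))ᗮ →L[ℝ] (ℝ ∙ (F x : E3))ᗮ :=
  LinearMap.toContinuousLinearMap
    ((tangentIso (F x)).toLinearMap ∘ₗ (mfderiv (𝓡 2) (𝓡 2) F x).toLinearMap ∘ₗ
      (tangentIso x).symm.toLinearMap)

/-! ### The unit tangent bundle, the projective bundle and Liouville measure -/

/-- The unit tangent bundle `T₁S²`: pairs of a point `x` and a unit vector orthogonal to `x`. -/
abbrev UnitTangent : Type := {p : S2 × S2 // ⟪(p.1 : E3), (p.2 : E3)⟫ = 0}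

/-- The base point of a unit tangent vector. -/
def UnitTangent.base (p : UnitTangent) : S2 := p.1.1

/-- A unit tangent vector as an element of the tangent plane at its base point. -/
def UnitTangent.vec (p : UnitTangent) : (ℝ ∙ (p.base : E3))ᗮ :=
  ⟨(p.1.2 : E3), Submodule.mem_orthogonal_singleton_iff_inner_right.2 p.2⟩

/-- Unit tangent vectors span the same line if they have the same base point and agree up to
sign. -/
instance lineSetoid : Setoid UnitTangent where
  r p q := p.1.1 = q.1.1 ∧ (p.1.2 = q.1.2 ∨ p.1.2 = -q.1.2)
  iseqv :=
    { refl := fun _ => ⟨rfl, Or.inl rfl⟩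
      symm := by
        rintro p q ⟨h, h' | h'⟩
        · exact ⟨h.symm, Or.inl h'.symm⟩
        · exact ⟨h.symm, Or.inr (by rw [h', neg_neg])⟩
      trans := by
        rintro p q r ⟨h₁, h₂⟩ ⟨h₃, h₄⟩
        refine ⟨h₁.trans h₃, ?_⟩
        rcases h₂ with h₂ | h₂ <;> rcases h₄ with h₄ | h₄ <;> simp [h₂, h₄] }

/-- The projective bundle `PS²`, whose points are the lines in the tangent planes of `S²`; it
carries the quotient σ-algebra. -/
abbrev ProjTangent : Type := Quotient lineSetoid

/-- A Borel choice of a unit vector orthogonal to `x`: the eastward direction, and the first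
coordinate vector at the two poles. -/
def frameFst (x : S2) : E3 :=
  if (x : E3) 0 ^ 2 + (x : E3) 1 ^ 2 = 0 then !₂[1, 0, 0]
  else (Real.sqrt ((x : E3) 0 ^ 2 + (x : E3) 1 ^ 2))⁻¹ • !₂[-(x : E3) 1, (x : E3) 0, 0]

/-- The vector product of `x` and `frameFst x`, which completes `frameFst x` to an orthonormal
basis of the tangent plane at `x`. -/
def frameSnd (x : S2) : E3 :=
  WithLp.toLp 2 (crossProduct (WithLp.ofLp (x : E3)) (WithLp.ofLp (frameFst x)))

theorem sq_sum (x : S2) : (x : E3) 0 ^ 2 + (x : E3) 1 ^ 2 + (x : E3) 2 ^ 2 = 1 := by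
  have h : ‖(x : E3)‖ = 1 := by simp
  have := EuclideanSpace.real_norm_sq_eq (x : E3)
  rw [h, Fin.sum_univ_three] at this
  linarith

theorem frameFst_props (x : S2) :
    frameFst x 0 * (x : E3) 0 + frameFst x 1 * (x : E3) 1 + frameFst x 2 * (x : E3) 2 = 0 ∧
    frameFst x 0 ^ 2 + frameFst x 1 ^ 2 + frameFst x 2 ^ 2 = 1 := by
  unfold frameFst
  split_ifs with h
  · have h0 : (x : E3) 0 = 0 := by nlinarith [sq_nonneg ((x : E3) 0), sq_nonneg ((x : E3) 1)]
    simp [h0]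
  · have hs : Real.sqrt ((x : E3) 0 ^ 2 + (x : E3) 1 ^ 2) ≠ 0 := by
      rw [Real.sqrt_ne_zero (by positivity)]; exact h
    have h2 := Real.sq_sqrt (show 0 ≤ (x : E3) 0 ^ 2 + (x : E3) 1 ^ 2 by positivity)
    constructor
    · simp; ring
    · simp only [PiLp.smul_apply, smul_eq_mul]
      simp [mul_pow]
      field_simp
      linarith

/-- The unit vector `cos θ • a + sin θ • b` of the tangent plane at `x`, where `(a, b)` is the
chosen orthonormal basis of that plane. -/
def unitVec (x : S2) (θ : ℝ) : E3 := Real.cos θ • frameFst x + Real.sin θ • frameSnd x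

theorem unitVec_mem (x : S2) (θ : ℝ) : unitVec x θ ∈ Metric.sphere (0 : E3) 1 := by
  obtain ⟨h1, h2⟩ := frameFst_props x
  have h3 := sq_sum x
  have h4 := Real.sin_sq_add_cos_sq θ
  rw [mem_sphere_zero_iff_norm, ← sq_eq_sq₀ (norm_nonneg _) zero_le_one,
    EuclideanSpace.real_norm_sq_eq, Fin.sum_univ_three]
  simp [unitVec, frameSnd, crossProduct]
  generalize frameFst x 0 = a at *
  generalize frameFst x 1 = b at *
  generalize frameFst x 2 = c at *
  generalize (x : E3) 0 = u at *
  generalize (x : E3) 1 = v at *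
  generalize (x : E3) 2 = w at *
  generalize Real.cos θ = k at *
  generalize Real.sin θ = s at *
  have h5 : (v * c - w * b) ^ 2 + (w * a - u * c) ^ 2 + (u * b - v * a) ^ 2 = 1 := by
    have : (v * c - w * b) ^ 2 + (w * a - u * c) ^ 2 + (u * b - v * a) ^ 2
      = (u^2+v^2+w^2) * (a^2+b^2+c^2) - (a*u+b*v+c*w)^2 := by ring
    rw [this, h1, h2, h3]; norm_num
  linear_combination k ^ 2 * h2 + s ^ 2 * h5 + h4

theorem inner_unitVec (x : S2) (θ : ℝ) : ⟪(x : E3), unitVec x θ⟫ = 0 := by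
  obtain ⟨h1, -⟩ := frameFst_props x
  simp [unitVec, frameSnd, crossProduct, PiLp.inner_apply, Fin.sum_univ_three]
  linear_combination Real.cos θ * h1

/-- The unit tangent vector at `x` with angle `θ` in the chosen basis. -/
def unitTangentOf (q : S2 × ℝ) : UnitTangent :=
  ⟨(q.1, ⟨unitVec q.1 q.2, unitVec_mem q.1 q.2⟩), inner_unitVec q.1 q.2⟩

/-- Normalized Liouville measure on `T₁S²`: the base point is distributed according to
normalized area and, given the base point, the vector is uniformly distributed on the unit circle
of the tangent plane. (The circle is parametrized by an angle; a different orthonormal basis of the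
plane shifts or reflects the angle and gives the same measure.) -/
def liouvilleUnit : Measure UnitTangent :=
  (area.prod (ProbabilityTheory.cond (volume : Measure ℝ) (Ioc 0 (2 * Real.pi)))).map
    unitTangentOf

/-- Normalized Liouville measure `m` on `PS²`. -/
def liouville : Measure ProjTangent := liouvilleUnit.map (Quotient.mk lineSetoid)

/-- The function `v ↦ log ‖T F v‖` on `PS²`, where a line is represented by either of its unit
vectors. -/
def logStretch (F : S2 → S2) : ProjTangent → ℝ :=
  Quotient.lift (fun p : UnitTangent => Real.log ‖sphereDeriv F p.base p.vec‖) (by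
    rintro ⟨⟨x, v⟩, hp⟩ ⟨⟨y, w⟩, hq⟩ ⟨h₁, h₂⟩
    obtain rfl : x = y := h₁
    rcases h₂ with h₂ | h₂
    · obtain rfl : v = w := h₂
      rfl
    · obtain rfl : v = -w := h₂
      have : UnitTangent.vec ⟨(x, -w), hp⟩ = -UnitTangent.vec ⟨(x, w), hq⟩ := rfl
      change Real.log ‖sphereDeriv F x (UnitTangent.vec ⟨(x, -w), hp⟩)‖ =
        Real.log ‖sphereDeriv F x (UnitTangent.vec ⟨(x, w), hq⟩)‖
      rw [this]
      congr 1
      exact (congrArg norm (map_neg (sphereDeriv F x) (UnitTangent.vec ⟨(x, w), hq⟩))).trans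
        (norm_neg _))

/-! ### Random composition of diffeomorphisms -/

/-- The 1-jet of `F`, as a function on the unit tangent bundle. -/
def jet (F : S2 → S2) (p : UnitTangent) : E3 × E3 :=
  ((F p.base : E3), (sphereDeriv F p.base p.vec : E3))

/-- The `C¹` topology on diffeomorphisms of the sphere: uniform convergence of the maps and of
their tangent maps on unit vectors. -/
instance diffeoTopology : TopologicalSpace SphereDiffeo :=
  TopologicalSpace.induced (fun f => UniformFun.ofFun (jet f)) inferInstance

instance diffeoMeasurableSpace : MeasurableSpace SphereDiffeo := borel SphereDiffeo

instance diffeoBorelSpace : BorelSpace SphereDiffeo := ⟨rfl⟩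

/-- The composition `h^{(n)} = h_n ∘ ⋯ ∘ h_1` (the sequence being indexed from `0`). -/
def iterComp (h : ℕ → SphereDiffeo) : ℕ → SphereDiffeo
  | 0 => Diffeomorph.refl (𝓡 2) S2 1
  | n + 1 => (iterComp h n).trans (h n)

/-- `R` is the random exponent of the Borel probability measure `ν` on diffeomorphisms of `S²`:
for almost every independent `ν`-distributed sequence, the limit of `n⁻¹ log ‖T_x h^{(n)}‖` exists
for almost every `x`, and its integral over the sphere is `R`. -/
def HasRandomExponent (ν : Measure SphereDiffeo) [IsProbabilityMeasure ν] (R : ℝ) : Prop :=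
  ∀ᵐ h ∂Measure.infinitePi (fun _ : ℕ => ν), ∃ L : S2 → ℝ,
    (∀ᵐ x ∂area, Tendsto
      (fun n : ℕ => (1 / (n : ℝ)) * Real.log ‖sphereDeriv (iterComp h n) x‖) atTop (𝓝 (L x))) ∧
    Integrable L area ∧ ∫ x, L x ∂area = R

theorem HasRandomExponent.unique {ν : Measure SphereDiffeo} [IsProbabilityMeasure ν] {R R' : ℝ}
    (h : HasRandomExponent ν R) (h' : HasRandomExponent ν R') : R = R' := by
  obtain ⟨w, ⟨L, hL, -, hR⟩, ⟨L', hL', -, hR'⟩⟩ := (h.and h').exists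
  rw [← hR, ← hR']
  refine integral_congr_ae ?_
  filter_upwards [hL, hL'] with x hx hx'
  exact tendsto_nhds_unique hx hx'

/-! ### Rotations, Haar measure and the coset of a diffeomorphism -/

/-- The rotation group. -/
abbrev SO3 : Type := Matrix.specialOrthogonalGroup (Fin 3) ℝ

instance : MeasurableSpace SO3 := borel SO3

instance : BorelSpace SO3 := ⟨rfl⟩

instance : IsTopologicalGroup SO3 where
  continuous_inv :=
    Continuous.subtype_mk (continuous_subtype_val.matrix_conjTranspose) _

instance : CompactSpace SO3 := by
  refine (isCompact_iff_compactSpace (s := ((Matrix.specialOrthogonalGroup (Fin 3) ℝ :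
    Submonoid (Matrix (Fin 3) (Fin 3) ℝ)) : Set (Matrix (Fin 3) (Fin 3) ℝ)))).1 ?_
  have hK : IsCompact (Set.pi univ fun _ : Fin 3 => Set.pi univ fun _ : Fin 3 => Icc (-1 : ℝ) 1) :=
    isCompact_univ_pi fun _ => isCompact_univ_pi fun _ => isCompact_Icc
  refine IsCompact.of_isClosed_subset (X := Matrix (Fin 3) (Fin 3) ℝ) hK ?_ ?_
  · have : ((Matrix.specialOrthogonalGroup (Fin 3) ℝ : Submonoid _) :
        Set (Matrix (Fin 3) (Fin 3) ℝ)) = {A | A * A.transpose = 1} ∩ {A | A.det = 1} := by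
      ext A
      simp [Matrix.mem_specialOrthogonalGroup_iff, Matrix.mem_orthogonalGroup_iff]
    rw [this]
    exact (isClosed_eq (continuous_id.matrix_mul continuous_id.matrix_transpose)
      continuous_const).inter (isClosed_eq continuous_id.matrix_det continuous_const)
  · intro A hA i _ j _
    have := entry_norm_bound_of_unitary (𝕜 := ℝ) hA.1 i j
    exact abs_le.1 this

/-- Haar measure on the rotation group, of total mass one. -/
def haarSO3 : Measure SO3 := Measure.haarMeasure ⊤

/-- The linear action of a rotation on `ℝ³`. -/
def rotLin (g : SO3) : E3 →L[ℝ] E3 := Matrix.toEuclideanCLM (𝕜 := ℝ) (g : Matrix _ _ ℝ)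

theorem rotLin_mul (g k : SO3) (y : E3) : rotLin (g * k) y = rotLin g (rotLin k y) := by
  simp [rotLin]

theorem rotLin_one (y : E3) : rotLin 1 y = y := by
  simp [rotLin]

theorem norm_rotLin (g : SO3) (y : E3) : ‖rotLin g y‖ = ‖y‖ := by
  have hu : rotLin g ∈ unitary (E3 →L[ℝ] E3) :=
    Unitary.map_mem (Matrix.toEuclideanCLM (n := Fin 3) (𝕜 := ℝ)) g.2.1
  exact (Unitary.linearIsometryEquiv ⟨_, hu⟩).norm_map y

theorem rotLin_mem (g : SO3) (x : S2) : rotLin g x ∈ Metric.sphere (0 : E3) 1 := by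
  simp [norm_rotLin]

/-- The action of a rotation on the sphere. -/
def rotFun (g : SO3) (x : S2) : S2 := ⟨rotLin g x, rotLin_mem g x⟩

theorem contMDiff_rotFun (g : SO3) : ContMDiff (𝓡 2) (𝓡 2) 1 (rotFun g) :=
  ContMDiff.codRestrict_sphere (n := 2)
    ((rotLin g).contMDiff.comp contMDiff_coe_sphere) (rotLin_mem g)

/-- A rotation as a diffeomorphism of the sphere. -/
def rot (g : SO3) : SphereDiffeo where
  toFun := rotFun g
  invFun := rotFun g⁻¹
  left_inv x := Subtype.ext (by simp [rotFun, ← rotLin_mul, rotLin_one])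
  right_inv x := Subtype.ext (by simp [rotFun, ← rotLin_mul, rotLin_one])
  contMDiff_toFun := contMDiff_rotFun g
  contMDiff_invFun := contMDiff_rotFun g⁻¹

/-- The push-forward `ν` of Haar measure on `SO(3)` to the coset `{g ∘ f | g ∈ SO(3)}` in the
group of diffeomorphisms of the sphere, under `g ↦ g ∘ f`. -/
def cosetMeasure (f : SphereDiffeo) : Measure SphereDiffeo :=
  haarSO3.map fun g => f.trans (rot g)

/-! ### The push-forward is a probability measure

What follows shows that `g ↦ g ∘ f` is continuous for the `C¹` topology. -/

theorem coe_tangentIso (x : S2) (w : TangentSpace (𝓡 2) x) :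
    (tangentIso x w : E3) = mvfderiv (𝓡 2) ((↑) : S2 → E3) x w := rfl

theorem sphereDeriv_tangentIso (F : S2 → S2) (x : S2) (w : TangentSpace (𝓡 2) x) :
    sphereDeriv F x (tangentIso x w) = tangentIso (F x) (mfderiv (𝓡 2) (𝓡 2) F x w) := by
  simp [sphereDeriv]

theorem hasMFDerivAt_coe (x : S2) : HasMFDerivAt (𝓡 2) 𝓘(ℝ, E3) ((↑) : S2 → E3) x
    (mfderiv (𝓡 2) 𝓘(ℝ, E3) ((↑) : S2 → E3) x) :=
  ((contMDiff_coe_sphere (m := 1) x).mdifferentiableAt one_ne_zero).hasMFDerivAt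

/-- If `G : ℝ³ → ℝ³` extends `F` then its derivative extends the tangent map of `F`. -/
theorem coe_sphereDeriv_of_extension {F : S2 → S2} {x : S2}
    (hF : MDifferentiableAt (𝓡 2) (𝓡 2) F x) {G : E3 → E3} (hG : DifferentiableAt ℝ G x)
    (h : ∀ y : S2, G y = F y) (v : (ℝ ∙ (x : E3))ᗮ) :
    (sphereDeriv F x v : E3) = fderiv ℝ G x v := by
  obtain ⟨w, rfl⟩ := (tangentIso x).surjective v
  rw [sphereDeriv_tangentIso, coe_tangentIso, coe_tangentIso]
  have h1 := (hasMFDerivAt_coe (F x)).comp x hF.hasMFDerivAt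
  have h2 := (hG.hasFDerivAt.hasMFDerivAt).comp x (hasMFDerivAt_coe x)
  have h3 : ((↑) : S2 → E3) ∘ F = G ∘ ((↑) : S2 → E3) := by
    funext y; exact (h y).symm
  rw [h3] at h1
  exact congrArg (fun l => l w) (hasMFDerivAt_unique h1 h2)

theorem coe_sphereDeriv_rot_comp (f : SphereDiffeo) (g : SO3) (x : S2) (v : (ℝ ∙ (x : E3))ᗮ) :
    (sphereDeriv (f.trans (rot g)) x v : E3) = rotLin g (sphereDeriv f x v) := by
  obtain ⟨w, rfl⟩ := (tangentIso x).surjective v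
  rw [sphereDeriv_tangentIso, sphereDeriv_tangentIso, coe_tangentIso, coe_tangentIso]
  have hf := (f.contMDiff_toFun x).mdifferentiableAt one_ne_zero
  have hfg := ((f.trans (rot g)).contMDiff_toFun x).mdifferentiableAt one_ne_zero
  have h1 := (hasMFDerivAt_coe (f.trans (rot g) x)).comp x hfg.hasMFDerivAt
  have h2 := ((rotLin g).hasFDerivAt.hasMFDerivAt).comp x
    ((hasMFDerivAt_coe (f x)).comp x hf.hasMFDerivAt)
  exact congrArg (fun l => l w) (hasMFDerivAt_unique h1 h2)

theorem contDiffAt_extension (f : SphereDiffeo) :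
    ∃ G : E3 → E3, (∀ y : S2, G y = f y) ∧ ContDiffOn ℝ 1 G {0}ᶜ := by
  let U : TopologicalSpace.Opens E3 := ⟨{0}ᶜ, isOpen_compl_singleton⟩
  have hn : ∀ y : U, ‖(y : E3)‖⁻¹ • (y : E3) ∈ Metric.sphere (0 : E3) 1 := by
    intro y
    have : ‖(y : E3)‖ ≠ 0 := norm_ne_zero_iff.2 y.2
    rw [mem_sphere_zero_iff_norm, norm_smul, norm_inv, norm_norm, inv_mul_cancel₀ this]
  have h1 : ContMDiff 𝓘(ℝ, E3) 𝓘(ℝ, E3) 1 fun y : U => ‖(y : E3)‖⁻¹ • (y : E3) := by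
    intro y
    have hy : (y : E3) ≠ 0 := y.2
    have : ContDiffAt ℝ 1 (fun z : E3 => ‖z‖⁻¹ • z) y :=
      ((contDiffAt_norm ℝ hy).inv (norm_ne_zero_iff.2 hy)).smul contDiffAt_id
    exact this.contMDiffAt.comp y contMDiff_subtype_val.contMDiffAt
  have h2 := ContMDiff.codRestrict_sphere (n := 2) h1 hn
  have h3 := (contMDiff_coe_sphere (m := 1) (n := 2)).comp (f.contMDiff_toFun.comp h2)
  classical
  let G : E3 → E3 := fun y => if h : y ∈ U then (f ⟨‖y‖⁻¹ • y, hn ⟨y, h⟩⟩ : E3) else 0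
  refine ⟨G, ?_, ?_⟩
  · intro y
    have hy : (y : E3) ∈ U := ne_zero_of_mem_unit_sphere y
    have : (⟨‖(y : E3)‖⁻¹ • (y : E3), hn ⟨y, hy⟩⟩ : S2) = y := Subtype.ext (by simp)
    simp only [G, dif_pos hy, this]
  · intro y hy
    have h4 : ContMDiffAt 𝓘(ℝ, E3) 𝓘(ℝ, E3) 1 (fun z : U => G z) ⟨y, hy⟩ := by
      refine (h3 ⟨y, hy⟩).congr_of_eventuallyEq (Eventually.of_forall fun z => ?_)
      simp only [G, dif_pos z.2]
      rfl
    exact ((contMDiffAt_subtype_iff (U := U) (f := G) (x := ⟨y, hy⟩)).1 h4).contDiffAt.contDiffWithinAt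

theorem exists_norm_sphereDeriv_le (f : SphereDiffeo) :
    ∃ C : ℝ, ∀ p : UnitTangent, ‖(sphereDeriv f p.base p.vec : E3)‖ ≤ C := by
  obtain ⟨G, hG, hG'⟩ := contDiffAt_extension f
  have hc : ContinuousOn (fderiv ℝ G) {0}ᶜ :=
    hG'.continuousOn_fderiv_of_isOpen isOpen_compl_singleton le_rfl
  obtain ⟨C, hC⟩ := (isCompact_sphere (0 : E3) 1).exists_bound_of_continuousOn
    (hc.mono fun y hy => ne_zero_of_mem_unit_sphere ⟨y, hy⟩)
  refine ⟨C, fun p => ?_⟩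
  have hp : (p.base : E3) ∈ ({0}ᶜ : Set E3) := ne_zero_of_mem_unit_sphere p.base
  rw [coe_sphereDeriv_of_extension (F := f) ((f.contMDiff_toFun _).mdifferentiableAt one_ne_zero)
    ((hG'.contDiffAt (isOpen_compl_singleton.mem_nhds hp)).differentiableAt one_ne_zero) hG]
  refine (ContinuousLinearMap.le_opNorm _ _).trans ?_
  have : ‖((p.vec : (ℝ ∙ (p.base : E3))ᗮ) : E3)‖ = 1 := by
    simp [UnitTangent.vec]
  rw [this, mul_one]
  exact hC _ p.base.2

theorem continuous_coset (f : SphereDiffeo) :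
    Continuous fun g : SO3 => f.trans (rot g) := by
  obtain ⟨C, hC⟩ := exists_norm_sphereDeriv_le f
  have hrot : Continuous rotLin :=
    (LinearMap.continuous_of_finiteDimensional
      (Matrix.toEuclideanCLM (n := Fin 3) (𝕜 := ℝ)).toAlgEquiv.toLinearMap).comp
      continuous_subtype_val
  rw [continuous_induced_rng, continuous_iff_continuousAt]
  intro g₀
  rw [ContinuousAt, UniformFun.tendsto_iff_tendstoUniformly, Metric.tendstoUniformly_iff]
  intro ε hε
  have hD : 0 < max 1 C + 1 := by positivity
  have := (hrot.tendsto g₀).eventually (Metric.ball_mem_nhds _ (div_pos hε hD))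
  filter_upwards [this] with g hg p
  rw [dist_comm, dist_eq_norm] at hg
  have key : ∀ y : E3, ‖y‖ ≤ max 1 C → dist (rotLin g₀ y) (rotLin g y) < ε := by
    intro y hy
    rw [dist_eq_norm, ← sub_apply]
    calc _ ≤ ‖rotLin g₀ - rotLin g‖ * ‖y‖ := ContinuousLinearMap.le_opNorm _ _
      _ ≤ ε / (max 1 C + 1) * max 1 C := by gcongr
      _ < ε / (max 1 C + 1) * (max 1 C + 1) := by gcongr; linarith
      _ = ε := div_mul_cancel₀ _ hD.ne'
  have h1 := key (f p.base) (by simp)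
  have h2 := key (sphereDeriv f p.base p.vec) ((hC p).trans (le_max_right _ _))
  rw [← coe_sphereDeriv_rot_comp, ← coe_sphereDeriv_rot_comp] at h2
  exact max_lt h1 h2

instance : IsProbabilityMeasure haarSO3 :=
  ⟨by simpa [haarSO3] using Measure.haarMeasure_self (K₀ := (⊤ : TopologicalSpace.PositiveCompacts SO3))⟩

instance (f : SphereDiffeo) : IsProbabilityMeasure (cosetMeasure f) :=
  Measure.isProbabilityMeasure_map (continuous_coset f).measurable.aemeasurable
end RandomSphere
end

open RandomSphere

/-!
Rotations act transitively on the unit tangent bundle and preserve Liouville measure, and Haar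
measure on `SO(3)` is also right invariant. Hence under `ν` the image direction of any given unit
tangent vector has the law of Liouville measure, whatever the vector, so the successive directions
of a random orbit are independent and Liouville distributed; a rotation does not change lengths, so
each step stretches by the factor of `f`. The strong law of large numbers gives the exponent.

For positivity, let `a`, `b` be the images of an orthonormal basis of `T_x S²`. If `f` preserves
area then the Gram determinant of `a`, `b` is `1`, and the function
`θ ↦ log ‖cos θ • a + sin θ • b‖` is the restriction of a harmonic function of `e^{iθ}`, with mean
`log ((‖a‖² + ‖b‖² + 2) / 4) / 2`. This is nonnegative and vanishes only if `a`, `b` are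
orthonormal, so a zero exponent makes `T_x f` isometric for almost every `x`, hence for every `x`.
-/

noncomputable section

namespace RandomSphere

/-! ### Means over the circle -/

section CircleMean

variable {V : Type*} [NormedAddCommGroup V] [InnerProductSpace ℝ V]

/-- The uniform probability measure on a period `(0, 2π]` of angles, the fibre measure of
`liouvilleUnit`. -/
def angleMeasure : Measure ℝ := ProbabilityTheory.cond volume (Ioc 0 (2 * Real.pi))

instance : IsProbabilityMeasure angleMeasure := by
  refine ProbabilityTheory.cond_isProbabilityMeasure_of_finite ?_ measure_Ioc_lt_top.ne
  simp [Real.pi_pos]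

theorem integral_angleMeasure (g : ℝ → ℝ) :
    ∫ θ, g θ ∂angleMeasure = (2 * Real.pi)⁻¹ * ∫ θ in (0 : ℝ)..2 * Real.pi, g θ := by
  simp [angleMeasure, ProbabilityTheory.cond, intervalIntegral.integral_of_le Real.two_pi_pos.le,
    Real.pi_pos.le]

theorem lintegral_angleMeasure_add {φ : ℝ → ENNReal} (hφ : Function.Periodic φ (2 * Real.pi))
    (α : ℝ) : ∫⁻ θ, φ (α + θ) ∂angleMeasure = ∫⁻ θ, φ θ ∂angleMeasure := by
  rw [angleMeasure, ProbabilityTheory.cond, lintegral_smul_measure, lintegral_smul_measure]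
  congr 1
  have hshift := (measurePreserving_add_left (volume : Measure ℝ) α).setLIntegral_comp_preimage_emb
    (measurableEmbedding_addLeft α) φ (Ioc α (α + 2 * Real.pi))
  have hperiod := (isAddFundamentalDomain_Ioc Real.two_pi_pos α volume).setLIntegral_eq
    (isAddFundamentalDomain_Ioc Real.two_pi_pos 0 volume) φ fun n θ => hφ.map_vadd_zmultiples n θ
  simpa [hperiod] using hshift

theorem circleAverage_log_norm_add_mul_sq {α β : ℂ} (h : ‖β‖ < ‖α‖) :
    Real.circleAverage (fun z => Real.log ‖α + β * z ^ 2‖) 0 1 = Real.log ‖α‖ := by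
  rw [InnerProductSpace.HarmonicOnNhd.circleAverage_eq]
  · simp
  intro z hz
  have hz1 : ‖z‖ ≤ 1 := by simpa using hz
  refine AnalyticAt.harmonicAt_log_norm (by fun_prop) fun h0 => h.not_ge ?_
  calc ‖α‖ = ‖β‖ * ‖z‖ ^ 2 := by rw [eq_neg_of_add_eq_zero_left h0]; simp
    _ ≤ ‖β‖ := mul_le_of_le_one_right (norm_nonneg β) (pow_le_one₀ (norm_nonneg z) hz1)

theorem exists_norm_cos_smul_add_sin_smul (a b : V) {D : ℝ} (hD : 0 < D)
    (h : D ^ 2 = ‖a‖ ^ 2 * ‖b‖ ^ 2 - ⟪a, b⟫ ^ 2) :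
    ∃ α β : ℂ, ‖β‖ < ‖α‖ ∧ ‖α‖ ^ 2 = (‖a‖ ^ 2 + ‖b‖ ^ 2 + 2 * D) / 4 ∧
      ∀ θ : ℝ, ‖Real.cos θ • a + Real.sin θ • b‖ = ‖α + β * circleMap 0 1 θ ^ 2‖ := by
  set s := √((‖a‖ ^ 2 + ‖b‖ ^ 2 + 2 * D) / 4)
  have hs : 0 < s := Real.sqrt_pos.2 (by positivity)
  have hs2 : s ^ 2 = (‖a‖ ^ 2 + ‖b‖ ^ 2 + 2 * D) / 4 := Real.sq_sqrt (by positivity)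
  set β : ℂ := ⟨(‖a‖ ^ 2 - ‖b‖ ^ 2) / (4 * s), -⟪a, b⟫ / (2 * s)⟩
  have hα : ‖(s : ℂ)‖ ^ 2 = (‖a‖ ^ 2 + ‖b‖ ^ 2 + 2 * D) / 4 := by simp [hs2]
  have hβ : ‖β‖ ^ 2 = (‖a‖ ^ 2 + ‖b‖ ^ 2 - 2 * D) / 4 := by
    rw [Complex.sq_norm, Complex.normSq_mk]
    field_simp
    rw [hs2]
    linear_combination 16 * h
  refine ⟨s, β, lt_of_pow_lt_pow_left₀ 2 (norm_nonneg _) (by rw [hα, hβ]; linarith), hα,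
    fun θ => (pow_left_inj₀ (norm_nonneg _) (norm_nonneg _) two_ne_zero).1 ?_⟩
  have hz : circleMap 0 1 θ ^ 2 = ⟨2 * Real.cos θ ^ 2 - 1, 2 * Real.sin θ * Real.cos θ⟩ := by
    rw [circleMap_zero, Complex.ofReal_one, one_mul, ← Complex.exp_nat_mul, ← Real.cos_two_mul,
      ← Real.sin_two_mul]
    apply Complex.ext <;> simp [Complex.exp_re, Complex.exp_im]
  calc ‖Real.cos θ • a + Real.sin θ • b‖ ^ 2
      = ‖a‖ ^ 2 * Real.cos θ ^ 2 + 2 * ⟪a, b⟫ * (Real.cos θ * Real.sin θ) +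
          ‖b‖ ^ 2 * Real.sin θ ^ 2 := by
        rw [norm_add_sq_real, real_inner_smul_left, real_inner_smul_right, norm_smul, norm_smul,
          mul_pow, mul_pow, Real.norm_eq_abs, Real.norm_eq_abs, sq_abs, sq_abs]
        ring
    _ = ‖(s : ℂ)‖ ^ 2 + ‖β‖ ^ 2 + 2 * (s * (β * circleMap 0 1 θ ^ 2).re) := by
        rw [hα, hβ, hz, Complex.mul_re, Real.sin_sq]
        simp only [β]
        field_simp
        ring
    _ = ‖s + β * circleMap 0 1 θ ^ 2‖ ^ 2 := by
        rw [add_comm (s : ℂ), Complex.sq_norm (_ + _), Complex.normSq_add,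
          Complex.normSq_eq_norm_sq, Complex.normSq_eq_norm_sq, Complex.conj_ofReal,
          Complex.re_mul_ofReal, norm_mul β, norm_pow, norm_circleMap_zero, abs_one, one_pow,
          mul_one]
        ring

theorem integral_log_norm_cos_smul_add_sin_smul (a b : V) {D : ℝ} (hD : 0 < D)
    (h : D ^ 2 = ‖a‖ ^ 2 * ‖b‖ ^ 2 - ⟪a, b⟫ ^ 2) :
    ∫ θ, Real.log ‖Real.cos θ • a + Real.sin θ • b‖ ∂angleMeasure =
      Real.log ((‖a‖ ^ 2 + ‖b‖ ^ 2 + 2 * D) / 4) / 2 := by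
  obtain ⟨α, β, hβα, hα, hθ⟩ := exists_norm_cos_smul_add_sin_smul a b hD h
  simp only [hθ]
  rw [integral_angleMeasure, ← hα, Real.log_pow, Nat.cast_ofNat, mul_div_cancel_left₀ _ two_ne_zero]
  exact circleAverage_log_norm_add_mul_sq hβα

theorem integral_log_norm_cos_smul_add_sin_smul_nonneg {a b : V}
    (h : ‖a‖ ^ 2 * ‖b‖ ^ 2 - ⟪a, b⟫ ^ 2 = 1) :
    0 ≤ ∫ θ, Real.log ‖Real.cos θ • a + Real.sin θ • b‖ ∂angleMeasure := by
  rw [integral_log_norm_cos_smul_add_sin_smul a b one_pos (by rw [h, one_pow])]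
  refine div_nonneg (Real.log_nonneg ?_) two_pos.le
  nlinarith [sq_nonneg (‖a‖ ^ 2 - ‖b‖ ^ 2), sq_nonneg ⟪a, b⟫, sq_nonneg ‖a‖, sq_nonneg ‖b‖]

theorem norm_eq_one_of_integral_log_norm_eq_zero {a b : V}
    (h : ‖a‖ ^ 2 * ‖b‖ ^ 2 - ⟪a, b⟫ ^ 2 = 1)
    (h0 : ∫ θ, Real.log ‖Real.cos θ • a + Real.sin θ • b‖ ∂angleMeasure = 0) :
    ‖a‖ = 1 ∧ ‖b‖ = 1 ∧ ⟪a, b⟫ = 0 := by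
  rw [integral_log_norm_cos_smul_add_sin_smul a b one_pos (by rw [h, one_pow]),
    div_eq_zero_iff, or_iff_left two_ne_zero] at h0
  have hsum : ‖a‖ ^ 2 + ‖b‖ ^ 2 = 2 := by
    have := Real.eq_one_of_pos_of_log_eq_zero (by positivity) h0
    linarith
  have hab : (‖a‖ ^ 2 - ‖b‖ ^ 2) ^ 2 + 4 * ⟪a, b⟫ ^ 2 = 0 := by
    linear_combination (‖a‖ ^ 2 + ‖b‖ ^ 2 + 2) * hsum - 4 * h
  have hinner : ⟪a, b⟫ = 0 := by nlinarith [sq_nonneg (‖a‖ ^ 2 - ‖b‖ ^ 2), sq_nonneg ⟪a, b⟫]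
  have heq : ‖a‖ ^ 2 - ‖b‖ ^ 2 = 0 := by
    nlinarith [sq_nonneg (‖a‖ ^ 2 - ‖b‖ ^ 2), sq_nonneg ⟪a, b⟫]
  refine ⟨?_, ?_, hinner⟩ <;>
    exact (pow_eq_one_iff_of_nonneg (norm_nonneg _) two_ne_zero).1 (by linarith)

end CircleMean

/-! ### Determinants -/

theorem det_sq_eq_det_gram {ι V : Type*} [Fintype ι] [DecidableEq ι] [NormedAddCommGroup V]
    [InnerProductSpace ℝ V] (b : OrthonormalBasis ι ℝ V) (T : V →ₗ[ℝ] V) :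
    LinearMap.det T ^ 2 = (Matrix.gram ℝ fun i => T (b i)).det := by
  rw [Matrix.gram_eq_conjTranspose_mul b, Matrix.det_mul, Matrix.det_conjTranspose, star_trivial,
    ← sq, ← LinearMap.det_toMatrix b.toBasis]
  congr 2
  ext i j
  simp [LinearMap.toMatrix_apply]

theorem abs_det_fderiv_eq_one {V : Type*} [NormedAddCommGroup V] [NormedSpace ℝ V]
    [FiniteDimensional ℝ V] [MeasurableSpace V] [BorelSpace V] {μ : Measure V} [μ.IsAddHaarMeasure]
    {f : V → V} {U : Set V} (hU : IsOpen U) (hf : ContDiffOn ℝ 1 f U) (hinj : InjOn f U)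
    (hμ : ∀ s ⊆ U, MeasurableSet s → μ (f '' s) = μ s) {x : V} (hx : x ∈ U) :
    |(fderiv ℝ f x).det| = 1 := by
  have hderiv : ∀ y ∈ U, HasFDerivAt f (fderiv ℝ f y) y := fun y hy =>
    ((hf.contDiffAt (hU.mem_nhds hy)).differentiableAt one_ne_zero).hasFDerivAt
  have hcont : ContinuousOn (fun y => ENNReal.ofReal |(fderiv ℝ f y).det|) U :=
    ENNReal.continuous_ofReal.comp_continuousOn
      (ContinuousLinearMap.continuous_det.comp_continuousOn
        (hf.continuousOn_fderiv_of_isOpen hU le_rfl)).abs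
  have hae : (fun y => ENNReal.ofReal |(fderiv ℝ f y).det|) =ᵐ[μ.restrict U] fun _ => 1 := by
    refine ae_eq_of_forall_setLIntegral_eq_of_sigmaFinite₀ (hcont.aemeasurable hU.measurableSet)
      aemeasurable_const fun s hs _ => ?_
    have hsU : MeasurableSet (s ∩ U) := hs.inter hU.measurableSet
    rw [Measure.restrict_restrict hs, setLIntegral_one, ← hμ _ inter_subset_right hsU]
    exact lintegral_abs_det_fderiv_eq_addHaar_image μ hsU
      (fun y hy => (hderiv y hy.2).hasFDerivWithinAt) (hinj.mono inter_subset_right)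
  simpa using Measure.eqOn_open_of_ae_eq hae hU hcont continuousOn_const hx

/-! ### Homogeneous extension of a map of unit spheres -/

section HomogeneousExtension

variable {V W X : Type*} [NormedAddCommGroup V] [NormedSpace ℝ V] [NormedAddCommGroup W]
  [NormedSpace ℝ W] [NormedAddCommGroup X] [NormedSpace ℝ X]

theorem exists_eq_smul_coe_sphere {y : V} (hy : y ≠ 0) :
    ∃ r : ℝ, 0 < r ∧ ∃ x : Metric.sphere (0 : V) 1, y = r • (x : V) :=
  ⟨‖y‖, norm_pos_iff.2 hy, ⟨‖y‖⁻¹ • y, by simp [norm_smul, hy]⟩, by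
    simp [smul_smul, norm_ne_zero_iff.2 hy]⟩

open Classical in
/-- The positively homogeneous extension, of degree one, of a map of unit spheres. It sends `0` to
`0`, where it is in general not differentiable. -/
def homExt (f : Metric.sphere (0 : V) 1 → Metric.sphere (0 : W) 1) (y : V) : W :=
  if h : y = 0 then 0 else ‖y‖ • (f ⟨‖y‖⁻¹ • y, by simp [norm_smul, h]⟩ : W)

variable (f : Metric.sphere (0 : V) 1 → Metric.sphere (0 : W) 1)

@[simp]
theorem homExt_zero : homExt f 0 = 0 := by simp [homExt]

theorem homExt_smul_coe {r : ℝ} (hr : 0 < r) (x : Metric.sphere (0 : V) 1) :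
    homExt f (r • (x : V)) = r • (f x : W) := by
  have hnorm : ‖r • (x : V)‖ = r := by simp [norm_smul, abs_of_pos hr]
  rw [homExt, dif_neg (smul_ne_zero hr.ne' (ne_zero_of_mem_unit_sphere x))]
  simp only [hnorm, smul_smul, inv_mul_cancel₀ hr.ne', one_smul]

@[simp]
theorem homExt_coe (x : Metric.sphere (0 : V) 1) : homExt f x = f x := by
  simpa using homExt_smul_coe f one_pos x

theorem homExt_smul {r : ℝ} (hr : 0 < r) (y : V) : homExt f (r • y) = r • homExt f y := by
  obtain rfl | hy := eq_or_ne y 0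
  · simp
  · obtain ⟨s, hs, x, rfl⟩ := exists_eq_smul_coe_sphere hy
    rw [smul_smul, homExt_smul_coe f (mul_pos hr hs), homExt_smul_coe f hs, smul_smul]

theorem homExt_comp (g : Metric.sphere (0 : W) 1 → Metric.sphere (0 : X) 1) :
    homExt (g ∘ f) = homExt g ∘ homExt f := by
  funext y
  obtain rfl | hy := eq_or_ne y 0
  · simp
  · obtain ⟨r, hr, x, rfl⟩ := exists_eq_smul_coe_sphere hy
    simp [homExt_smul_coe _ hr]

theorem homExt_id : homExt (id : Metric.sphere (0 : V) 1 → Metric.sphere (0 : V) 1) = id := by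
  funext y
  obtain rfl | hy := eq_or_ne y 0
  · simp
  · obtain ⟨r, hr, x, rfl⟩ := exists_eq_smul_coe_sphere hy
    simp [homExt_smul_coe _ hr]

variable {f} in
theorem leftInverse_homExt {g : Metric.sphere (0 : W) 1 → Metric.sphere (0 : V) 1}
    (h : Function.LeftInverse g f) : Function.LeftInverse (homExt g) (homExt f) :=
  Function.leftInverse_iff_comp.2 <| by rw [← homExt_comp, h.comp_eq_id, homExt_id]

theorem fderiv_homExt_smul {r : ℝ} (hr : 0 < r) (y : V) :
    fderiv ℝ (homExt f) (r • y) = fderiv ℝ (homExt f) y := by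
  have : Invertible r := invertibleOfNonzero hr.ne'
  refine smul_right_injective _ hr.ne' ?_
  beta_reduce
  rw [← fderiv_comp_smul, funext fun y => homExt_smul f hr y]
  exact fderiv_const_smul_of_invertible r

variable {f}

theorem fderiv_homExt_coe_self {x : Metric.sphere (0 : V) 1}
    (h : DifferentiableAt ℝ (homExt f) x) : fderiv ℝ (homExt f) x x = f x := by
  have hline : HasDerivAt (fun r : ℝ => homExt f (r • (x : V))) (fderiv ℝ (homExt f) x x) 1 := by
    rw [← one_smul ℝ (x : V)] at h
    simpa [Function.comp_def] using
      h.hasFDerivAt.comp_hasDerivAt 1 ((hasDerivAt_id (1 : ℝ)).smul_const (x : V))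
  have hray : HasDerivAt (fun r : ℝ => r • (f x : W)) (f x : W) 1 := by
    simpa using (hasDerivAt_id (1 : ℝ)).smul_const (f x : W)
  refine hline.unique (hray.congr_of_eventuallyEq ?_)
  filter_upwards [lt_mem_nhds zero_lt_one] with r hr using homExt_smul_coe f hr x

theorem zero_notMem_segment_of_mem_sphere {x y : Metric.sphere (0 : V) 1} (h : (x : V) ≠ -y) :
    (0 : V) ∉ segment ℝ (x : V) (y : V) := by
  rintro ⟨s, t, hs, ht, hst, h0⟩
  have hsmul : s • (x : V) = t • -(y : V) := by rw [smul_neg, eq_neg_of_add_eq_zero_left h0]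
  have heq : s = t := by
    simpa [norm_smul, abs_of_nonneg hs, abs_of_nonneg ht] using congrArg norm hsmul
  have hne : t ≠ 0 := by rintro rfl; norm_num [heq] at hst
  exact h (smul_right_injective V hne (heq ▸ hsmul))

theorem dist_le_dist_of_norm_fderiv_homExt_le (hd : DifferentiableOn ℝ (homExt f) {0}ᶜ)
    (hle : ∀ x : Metric.sphere (0 : V) 1, ‖fderiv ℝ (homExt f) x‖ ≤ 1)
    (x y : Metric.sphere (0 : V) 1) : dist (f x) (f y) ≤ dist x y := by
  rw [Subtype.dist_eq, Subtype.dist_eq]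
  by_cases hxy : (x : V) = -y
  · have hx : dist (x : V) y = 1 + 1 := by
      rw [hxy, dist_eq_norm, ← neg_add', norm_neg, ← two_smul ℝ, norm_smul]
      norm_num
    rw [hx]
    exact (dist_le_norm_add_norm _ _).trans_eq (by simp)
  · have hne : ∀ z ∈ segment ℝ (y : V) x, z ≠ 0 := fun z hz h0 =>
      zero_notMem_segment_of_mem_sphere hxy (h0 ▸ segment_symm ℝ (x : V) y ▸ hz)
    have hbound : ∀ z ∈ segment ℝ (y : V) x, ‖fderiv ℝ (homExt f) z‖ ≤ 1 := fun z hz => by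
      obtain ⟨r, hr, w, rfl⟩ := exists_eq_smul_coe_sphere (hne z hz)
      rw [fderiv_homExt_smul f hr]
      exact hle w
    simpa [dist_eq_norm] using
      (convex_segment (𝕜 := ℝ) (y : V) x).norm_image_sub_le_of_norm_fderiv_le
      (fun z hz => hd.differentiableAt (isOpen_compl_singleton.mem_nhds (hne z hz))) hbound
      (left_mem_segment ℝ _ _) (right_mem_segment ℝ _ _)

theorem isometry_of_norm_fderiv_homExt_eq (e : Metric.sphere (0 : V) 1 ≃ Metric.sphere (0 : W) 1)
    (hd : DifferentiableOn ℝ (homExt e) {0}ᶜ) (hd' : DifferentiableOn ℝ (homExt e.symm) {0}ᶜ)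
    (h : ∀ (x : Metric.sphere (0 : V) 1) v, ‖fderiv ℝ (homExt e) x v‖ = ‖v‖) : Isometry e := by
  have hle (x : Metric.sphere (0 : V) 1) : ‖fderiv ℝ (homExt e) x‖ ≤ 1 :=
    ContinuousLinearMap.opNorm_le_bound _ zero_le_one fun v => by rw [one_mul, h]
  have hle' (y : Metric.sphere (0 : W) 1) : ‖fderiv ℝ (homExt e.symm) y‖ ≤ 1 := by
    refine ContinuousLinearMap.opNorm_le_bound _ zero_le_one fun v => ?_
    have hdy := hd'.differentiableAt
      (isOpen_compl_singleton.mem_nhds (ne_zero_of_mem_unit_sphere y))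
    have hdx := hd.differentiableAt
      (isOpen_compl_singleton.mem_nhds (ne_zero_of_mem_unit_sphere (e.symm y)))
    rw [← homExt_coe] at hdx
    have hchain := fderiv_comp (y : W) hdx hdy
    rw [(leftInverse_homExt e.apply_symm_apply).comp_eq_id, fderiv_id, homExt_coe] at hchain
    rw [one_mul, ← h (e.symm y), ← ContinuousLinearMap.comp_apply, ← hchain,
      ContinuousLinearMap.id_apply]
  refine Isometry.of_dist_eq fun x y => le_antisymm
    (dist_le_dist_of_norm_fderiv_homExt_le hd hle x y) ?_
  simpa using dist_le_dist_of_norm_fderiv_homExt_le hd' hle' (e x) (e y)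

theorem contDiffOn_homExt {V W : Type*} [NormedAddCommGroup V] [InnerProductSpace ℝ V]
    [NormedAddCommGroup W] [NormedSpace ℝ W]
    {f : Metric.sphere (0 : V) 1 → Metric.sphere (0 : W) 1} {G : V → W} {n : WithTop ℕ∞}
    (hG : ContDiffOn ℝ n G {0}ᶜ) (hGf : ∀ x : Metric.sphere (0 : V) 1, G x = f x) :
    ContDiffOn ℝ n (homExt f) {0}ᶜ := by
  have hnorm : ContDiffOn ℝ n (fun y : V => ‖y‖) {0}ᶜ := fun y hy =>
    (contDiffAt_norm ℝ hy).contDiffWithinAt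
  have hinv : ContDiffOn ℝ n (fun y : V => ‖y‖⁻¹) {0}ᶜ :=
    hnorm.inv fun y hy => norm_ne_zero_iff.2 hy
  have hradial : ContDiffOn ℝ n (fun y : V => ‖y‖ • G (‖y‖⁻¹ • y)) {0}ᶜ :=
    hnorm.smul (hG.comp (hinv.smul contDiffOn_id) fun y (hy : y ≠ 0) => by simp [hy])
  refine hradial.congr fun y (hy : y ≠ 0) => ?_
  rw [homExt, dif_neg hy, ← hGf]

section Measure

variable [FiniteDimensional ℝ V] [Nontrivial V] [MeasurableSpace V] [BorelSpace V]
  {μ : Measure V} [μ.IsAddHaarMeasure]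

theorem measurePreserving_homExt {f : Metric.sphere (0 : V) 1 → Metric.sphere (0 : V) 1}
    (hf : MeasurePreserving f μ.toSphere μ.toSphere) : MeasurePreserving (homExt f) μ μ := by
  set polar := (homeomorphUnitSphereProd V).toMeasurableEquiv
  have hcoe : MeasurePreserving ((↑) : ({0}ᶜ : Set V) → V) (μ.comap (↑)) μ :=
    ⟨measurable_subtype_coe, by
      rw [map_comap_subtype_coe (measurableSet_singleton 0).compl, restrict_compl_singleton]⟩
  have hpolar : MeasurePreserving (fun p => (polar.symm p : V)) _ μ :=
    hcoe.comp (MeasurePreserving.symm polar μ.measurePreserving_homeomorphUnitSphereProd)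
  have hsemi : Function.Semiconj (fun p => (polar.symm p : V)) (Prod.map f id) (homExt f) := by
    rintro ⟨x, r, hr⟩
    exact (homExt_smul_coe f hr x).symm
  refine hpolar.of_semiconj (hf.prod (.id _)) hsemi
    (measurable_of_measurable_on_compl_singleton 0 ?_)
  have hrestrict : ({0}ᶜ : Set V).domRestrict (homExt f) =
      (fun p => (polar.symm p : V)) ∘ Prod.map f id ∘ polar := by
    rw [← Function.comp_assoc, hsemi.comp_eq]
    funext y
    simp
  exact hrestrict ▸ hpolar.measurable.comp ((hf.measurable.prodMap measurable_id).comp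
    polar.measurable)

theorem measure_image_homExt (e : Metric.sphere (0 : V) 1 ≃ᵐ Metric.sphere (0 : V) 1)
    (he : MeasurePreserving e μ.toSphere μ.toSphere) {s : Set V} (hs : MeasurableSet s) :
    μ (homExt e '' s) = μ s := by
  rw [image_eq_preimage_of_inverse (leftInverse_homExt e.symm_apply_apply)
    (leftInverse_homExt e.apply_symm_apply)]
  exact (measurePreserving_homExt (he.symm e)).measure_preimage hs.nullMeasurableSet

theorem abs_det_fderiv_homExt_eq_one (e : Metric.sphere (0 : V) 1 ≃ᵐ Metric.sphere (0 : V) 1)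
    (he : MeasurePreserving e μ.toSphere μ.toSphere) (hd : ContDiffOn ℝ 1 (homExt e) {0}ᶜ)
    (x : Metric.sphere (0 : V) 1) : |(fderiv ℝ (homExt e) x).det| = 1 :=
  abs_det_fderiv_eq_one isOpen_compl_singleton hd
    (leftInverse_homExt e.symm_apply_apply).injective.injOn
    (fun _ _ hs => measure_image_homExt e he hs) (ne_zero_of_mem_unit_sphere x)

end Measure

end HomogeneousExtension

/-! ### Random orbits of a map with constant law -/

section RandomOrbit

open ProbabilityTheory

section ConstantLaw

variable {Ω α β γ : Type*} [MeasurableSpace Ω] [MeasurableSpace α] [MeasurableSpace β]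
  [MeasurableSpace γ] {P : Measure Ω} [IsProbabilityMeasure P] {m : Measure γ} [SFinite m]
  {Z : Ω → α} {H : Ω → β} {A : β → α → γ}

theorem map_prodMk_of_constant_law (hZ : Measurable Z) (hH : Measurable H) (hind : IndepFun Z H P)
    (hA : Measurable (Function.uncurry A)) (hlaw : ∀ z, (P.map H).map (A · z) = m) :
    P.map (fun a => (Z a, A (H a) (Z a))) = (P.map Z).prod m := by
  have hAZ : Measurable fun a => A (H a) (Z a) := hA.comp (hH.prodMk hZ)
  have hprod : P.map (fun a => (Z a, H a)) = (P.map Z).prod (P.map H) :=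
    (indepFun_iff_map_prod_eq_prod_map_map hZ.aemeasurable hH.aemeasurable).1 hind
  refine Measure.ext_of_lintegral _ fun φ hφ => ?_
  have hφA : Measurable fun q : α × β => φ (q.1, A q.2 q.1) :=
    hφ.comp (measurable_fst.prodMk (hA.comp measurable_swap))
  calc ∫⁻ r, φ r ∂P.map (fun a => (Z a, A (H a) (Z a)))
      = ∫⁻ a, φ (Z a, A (H a) (Z a)) ∂P := lintegral_map hφ (hZ.prodMk hAZ)
    _ = ∫⁻ q, φ (q.1, A q.2 q.1) ∂P.map (fun a => (Z a, H a)) :=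
        (lintegral_map hφA (hZ.prodMk hH)).symm
    _ = ∫⁻ z, ∫⁻ b, φ (z, A b z) ∂P.map H ∂P.map Z := by
        rw [hprod, lintegral_prod _ hφA.aemeasurable]
    _ = ∫⁻ z, ∫⁻ c, φ (z, c) ∂m ∂P.map Z := by
        refine lintegral_congr fun z => ?_
        rw [← hlaw z]
        exact (lintegral_map (hφ.comp measurable_prodMk_left)
          (hA.comp measurable_prodMk_right)).symm
    _ = ∫⁻ r, φ r ∂(P.map Z).prod m := (lintegral_prod _ hφ.aemeasurable).symm

theorem map_of_constant_law (hZ : Measurable Z) (hH : Measurable H) (hind : IndepFun Z H P)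
    (hA : Measurable (Function.uncurry A)) (hlaw : ∀ z, (P.map H).map (A · z) = m) :
    P.map (fun a => A (H a) (Z a)) = m := by
  have := Measure.isProbabilityMeasure_map (μ := P) hZ.aemeasurable
  have hsnd := congrArg Measure.snd (map_prodMk_of_constant_law hZ hH hind hA hlaw)
  rwa [Measure.snd_prod, Measure.snd_map_prodMk hZ] at hsnd

theorem indepFun_of_constant_law (hZ : Measurable Z) (hH : Measurable H) (hind : IndepFun Z H P)
    (hA : Measurable (Function.uncurry A)) (hlaw : ∀ z, (P.map H).map (A · z) = m) :
    IndepFun Z (fun a => A (H a) (Z a)) P := by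
  have hAZ : Measurable fun a => A (H a) (Z a) := hA.comp (hH.prodMk hZ)
  rw [indepFun_iff_map_prod_eq_prod_map_map hZ.aemeasurable hAZ.aemeasurable,
    map_of_constant_law hZ hH hind hA hlaw, map_prodMk_of_constant_law hZ hH hind hA hlaw]

end ConstantLaw

variable {H X : Type*}

/-- The orbit of `x` under the successive maps `step (h 0), step (h 1), …`; it is used with `h` an
independent random sequence. -/
def randomOrbit (step : H → X → X) (x : X) (h : ℕ → H) : ℕ → X
  | 0 => x
  | n + 1 => step (h n) (randomOrbit step x h n)

variable [MeasurableSpace H] [MeasurableSpace X] {step : H → X → X}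

theorem measurable_randomOrbit (hstep : Measurable (Function.uncurry step)) (n : ℕ) :
    Measurable fun q : X × (ℕ → H) => randomOrbit step q.1 q.2 n := by
  induction n with
  | zero => exact measurable_fst
  | succ n ih => exact hstep.comp (((measurable_pi_apply n).comp measurable_snd).prodMk ih)

theorem measurable_randomOrbit_right (hstep : Measurable (Function.uncurry step)) (x : X) (n : ℕ) :
    Measurable fun h : ℕ → H => randomOrbit step x h n :=
  (measurable_randomOrbit hstep n).comp measurable_prodMk_left

theorem measurable_iSup_comap_randomOrbit (hstep : Measurable (Function.uncurry step)) (x : X)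
    {i n : ℕ} (hi : i ≤ n) :
    Measurable[⨆ k ∈ Iio n, MeasurableSpace.comap (fun h : ℕ → H => h k) inferInstance]
      fun h : ℕ → H => randomOrbit step x h i := by
  induction i with
  | zero => exact measurable_const
  | succ i ih =>
    refine hstep.comp (.prodMk ?_ (ih (Nat.le_of_succ_le hi)))
    exact (comap_measurable (fun h : ℕ → H => h i)).mono
      (le_iSup₂ (f := fun k (_ : k ∈ Iio n) =>
        MeasurableSpace.comap (fun h : ℕ → H => h k) inferInstance) i hi) le_rfl

variable {ν : Measure H} [IsProbabilityMeasure ν]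

theorem indepFun_randomOrbit_eval (hstep : Measurable (Function.uncurry step)) (x : X) {i n : ℕ}
    (hi : i ≤ n) :
    IndepFun (fun h => (randomOrbit step x h i, randomOrbit step x h n)) (fun h => h n)
      (Measure.infinitePi fun _ : ℕ => ν) := by
  have hcoord : iIndepFun (fun (k : ℕ) (h : ℕ → H) => h k) (Measure.infinitePi fun _ : ℕ => ν) :=
    iIndepFun_infinitePi (X := fun _ h => h) fun _ => measurable_id
  have hpast := indep_iSup_of_disjoint (fun k => (measurable_pi_apply k).comap_le) hcoord
    (show Disjoint (Iio n) {n} by simp)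
  rw [iSup_singleton] at hpast
  refine indep_of_indep_of_le_left hpast (Measurable.comap_le ?_)
  exact (measurable_iSup_comap_randomOrbit hstep x hi).prodMk
    (measurable_iSup_comap_randomOrbit hstep x le_rfl)

variable {m : Measure X} [SFinite m]

theorem map_randomOrbit_succ (hstep : Measurable (Function.uncurry step))
    (hlaw : ∀ x, ν.map (step · x) = m) (x : X) (n : ℕ) :
    (Measure.infinitePi fun _ : ℕ => ν).map (fun h => randomOrbit step x h (n + 1)) = m := by
  have hind := (indepFun_randomOrbit_eval (ν := ν) hstep x (le_refl n)).comp
    measurable_snd measurable_id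
  refine map_of_constant_law (A := step) (measurable_randomOrbit_right hstep x n)
      (measurable_pi_apply n)
    hind hstep fun z => ?_
  rw [Measure.infinitePi_map_eval]
  exact hlaw z

theorem indepFun_randomOrbit_succ (hstep : Measurable (Function.uncurry step))
    (hlaw : ∀ x, ν.map (step · x) = m) (x : X) {i n : ℕ} (hi : i ≤ n) :
    IndepFun (fun h => randomOrbit step x h i) (fun h => randomOrbit step x h (n + 1))
      (Measure.infinitePi fun _ : ℕ => ν) := by
  have hpair := indepFun_of_constant_law (m := m)
    (P := Measure.infinitePi fun _ : ℕ => ν) (A := fun b (z : X × X) => step b z.2)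
    ((measurable_randomOrbit_right hstep x i).prodMk (measurable_randomOrbit_right hstep x n))
    (measurable_pi_apply n) (indepFun_randomOrbit_eval hstep x hi)
    (hstep.comp (measurable_fst.prodMk (measurable_snd.comp measurable_snd))) fun z => by
      rw [Measure.infinitePi_map_eval]
      exact hlaw z.2
  exact hpair.comp measurable_fst measurable_id

theorem identDistrib_randomOrbit_succ (hstep : Measurable (Function.uncurry step))
    (hlaw : ∀ x, ν.map (step · x) = m) (x : X) (n : ℕ) :
    IdentDistrib (fun h => randomOrbit step x h (n + 1)) id
      (Measure.infinitePi fun _ : ℕ => ν) m where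
  aemeasurable_fst := (measurable_randomOrbit_right hstep x _).aemeasurable
  aemeasurable_snd := aemeasurable_id
  map_eq := by rw [map_randomOrbit_succ hstep hlaw, Measure.map_id]

theorem tendsto_sum_range_div_of_succ {a : ℕ → ℝ} {R : ℝ}
    (h : Tendsto (fun n : ℕ => (∑ k ∈ Finset.range n, a (k + 1)) / n) atTop (𝓝 R)) :
    Tendsto (fun n : ℕ => (∑ k ∈ Finset.range n, a k) / n) atTop (𝓝 R) := by
  rw [← tendsto_add_atTop_iff_nat 1]
  have hfirst : Tendsto (fun n : ℕ => a 0 * (1 / ((n : ℝ) + 1))) atTop (𝓝 0) := by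
    simpa only [mul_zero] using tendsto_one_div_add_atTop_nhds_zero_nat.const_mul (a 0)
  have hratio : Tendsto (fun n : ℕ => (n : ℝ) / (n + 1)) atTop (𝓝 1) :=
    tendsto_natCast_div_add_atTop 1
  have hsum := (h.mul hratio).add hfirst
  rw [mul_one, add_zero] at hsum
  refine hsum.congr fun n => ?_
  rw [Finset.sum_range_succ', Nat.cast_add_one]
  rcases eq_or_ne n 0 with rfl | hn
  · simp
  · field_simp

theorem ae_tendsto_average_randomOrbit (hstep : Measurable (Function.uncurry step))
    (hlaw : ∀ x, ν.map (step · x) = m) {φ : X → ℝ} (hφ : Measurable φ) (hint : Integrable φ m)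
    (x : X) :
    ∀ᵐ h ∂Measure.infinitePi fun _ : ℕ => ν,
      Tendsto (fun n : ℕ => (∑ k ∈ Finset.range n, φ (randomOrbit step x h k)) / n) atTop
        (𝓝 (∫ y, φ y ∂m)) := by
  have hid n := (identDistrib_randomOrbit_succ hstep hlaw x n).comp hφ
  have hindep : Pairwise fun i j : ℕ => IndepFun (fun h => φ (randomOrbit step x h (i + 1)))
      (fun h => φ (randomOrbit step x h (j + 1))) (Measure.infinitePi fun _ : ℕ => ν) := by
    have hlt : ∀ {i j : ℕ}, i < j → IndepFun (fun h => φ (randomOrbit step x h (i + 1)))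
        (fun h => φ (randomOrbit step x h (j + 1))) (Measure.infinitePi fun _ : ℕ => ν) :=
      fun hij => (indepFun_randomOrbit_succ hstep hlaw x hij).comp hφ hφ
    exact fun i j hij => hij.lt_or_gt.elim hlt fun hji => (hlt hji).symm
  have hlln := strong_law_ae_real _ ((hid 0).integrable_iff.2 hint) hindep
    fun n => (hid n).trans (hid 0).symm
  filter_upwards [hlln] with h hh
  exact tendsto_sum_range_div_of_succ ((hid 0).integral_eq ▸ hh)

end RandomOrbit

/-! ### Transitive actions and invariant measures -/

theorem isMulRightInvariant_of_isHaarMeasure {G : Type*} [Group G] [TopologicalSpace G]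
    [IsTopologicalGroup G] [LocallyCompactSpace G] [MeasurableSpace G] [BorelSpace G]
    (μ : Measure G) [μ.IsHaarMeasure] [IsProbabilityMeasure μ] : μ.IsMulRightInvariant where
  map_mul_right_eq_self k := by
    have := Measure.isProbabilityMeasure_map (μ := μ) (measurable_mul_const k).aemeasurable
    exact Measure.isHaarMeasure_eq_of_isProbabilityMeasure _ _

section Transitive

variable {G X : Type*} [Group G] [MeasurableSpace G] [MeasurableMul G] [MeasurableSpace X]
  [MulAction G X] [MeasurableSMul₂ G X] [MulAction.IsPretransitive G X] (μ : Measure G)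

theorem map_smul_const_eq_map_smul_const [μ.IsMulRightInvariant] (x y : X) :
    μ.map (· • x) = μ.map (· • y) := by
  obtain ⟨k, rfl⟩ := MulAction.exists_smul_eq G x y
  have hx : Measurable fun g : G => g • x := by fun_prop
  conv_lhs => rw [← map_mul_right_eq_self μ k, Measure.map_map hx (measurable_mul_const k)]
  simp only [Function.comp_def, mul_smul]

theorem map_smul_const_eq_of_smulInvariantMeasure [IsProbabilityMeasure μ]
    [μ.IsMulRightInvariant] (m : Measure X) [IsProbabilityMeasure m] [SMulInvariantMeasure G X m]
    (x : X) : μ.map (· • x) = m := by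
  refine Measure.ext_of_lintegral _ fun φ hφ => ?_
  have hconst y : ∫⁻ g, φ (g • y) ∂μ = ∫⁻ z, φ z ∂μ.map (· • x) := by
    rw [map_smul_const_eq_map_smul_const μ x y, lintegral_map hφ (by fun_prop)]
  calc ∫⁻ z, φ z ∂μ.map (· • x)
      = ∫⁻ y, ∫⁻ g, φ (g • y) ∂μ ∂m := by simp only [hconst, lintegral_const, measure_univ, mul_one]
    _ = ∫⁻ g, ∫⁻ y, φ (g • y) ∂m ∂μ :=
        lintegral_lintegral_swap
          (hφ.comp (measurable_smul.comp measurable_swap)).aemeasurable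
    _ = ∫⁻ y, φ y ∂m := by
        simp only [(measurePreserving_smul _ m).lintegral_comp hφ, lintegral_const, measure_univ,
          mul_one]

end Transitive

/-! ### The tangent cocycle -/

theorem mdifferentiableAt_diffeo (f : SphereDiffeo) (x : S2) :
    MDifferentiableAt (𝓡 2) (𝓡 2) f x :=
  (f.contMDiff_toFun x).mdifferentiableAt one_ne_zero

theorem sphereDeriv_comp {F G : S2 → S2} {x : S2} (hG : MDifferentiableAt (𝓡 2) (𝓡 2) G (F x))
    (hF : MDifferentiableAt (𝓡 2) (𝓡 2) F x) :
    sphereDeriv (G ∘ F) x = (sphereDeriv G (F x)).comp (sphereDeriv F x) := by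
  ext1 v
  obtain ⟨w, rfl⟩ := (tangentIso x).surjective v
  simp [sphereDeriv_tangentIso, mfderiv_comp x hG hF]

theorem sphereDeriv_id (x : S2) : sphereDeriv id x = ContinuousLinearMap.id ℝ _ := by
  ext1 v
  obtain ⟨w, rfl⟩ := (tangentIso x).surjective v
  simp [sphereDeriv_tangentIso]

theorem injective_sphereDeriv (f : SphereDiffeo) (x : S2) :
    Function.Injective (sphereDeriv f x) :=
  (tangentIso (f x)).injective.comp <|
    (f.mfderivToContinuousLinearEquiv one_ne_zero x).injective.comp (tangentIso x).symm.injective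

/-- The image of a unit tangent vector under the tangent map of a diffeomorphism, seen in `ℝ³`. -/
def tangentImage (f : SphereDiffeo) (p : UnitTangent) : E3 := sphereDeriv f p.base p.vec

theorem inner_tangentImage (f : SphereDiffeo) (p : UnitTangent) :
    ⟪(f p.base : E3), tangentImage f p⟫ = 0 :=
  Submodule.mem_orthogonal_singleton_iff_inner_right.1 (sphereDeriv f p.base p.vec).2

theorem tangentImage_ne_zero (f : SphereDiffeo) (p : UnitTangent) : tangentImage f p ≠ 0 := by
  have hvec : p.vec ≠ 0 := fun h => ne_zero_of_mem_unit_sphere p.1.2 (congrArg Subtype.val h)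
  exact (Submodule.coe_eq_zero.not).2 ((map_ne_zero_iff _ (injective_sphereDeriv f p.base)).2 hvec)

theorem unitTangent_ext {p q : UnitTangent} (hbase : p.1.1 = q.1.1)
    (hvec : (p.1.2 : E3) = q.1.2) : p = q :=
  Subtype.ext (Prod.ext hbase (Subtype.ext hvec))

/-- The normalized image of a unit tangent vector under the tangent map of a diffeomorphism. -/
def pushTangent (f : SphereDiffeo) (p : UnitTangent) : UnitTangent :=
  ⟨(f p.base, ⟨‖tangentImage f p‖⁻¹ • tangentImage f p, by
      simp [norm_smul, tangentImage_ne_zero f p]⟩), by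
    rw [inner_smul_right, inner_tangentImage, mul_zero]⟩

theorem base_pushTangent (f : SphereDiffeo) (p : UnitTangent) :
    (pushTangent f p).1.1 = f p.1.1 := rfl

theorem coe_pushTangent (f : SphereDiffeo) (p : UnitTangent) :
    ((pushTangent f p).1.2 : E3) = ‖tangentImage f p‖⁻¹ • tangentImage f p := rfl

/-- The logarithm of the factor by which a diffeomorphism stretches a unit tangent vector:
`logStretch` before passing to lines. -/
def logStretchUnit (f : SphereDiffeo) (p : UnitTangent) : ℝ := Real.log ‖tangentImage f p‖

theorem tangentImage_trans (f g : SphereDiffeo) (p : UnitTangent) :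
    tangentImage (f.trans g) p = ‖tangentImage f p‖ • tangentImage g (pushTangent f p) := by
  have hvec : sphereDeriv f p.base p.vec = ‖tangentImage f p‖ • (pushTangent f p).vec :=
    Subtype.ext (smul_inv_smul₀ (norm_ne_zero_iff.2 (tangentImage_ne_zero f p)) _).symm
  calc tangentImage (f.trans g) p = sphereDeriv g (f p.base) (sphereDeriv f p.base p.vec) :=
        congrArg (fun T => (T p.vec : E3)) <|
          sphereDeriv_comp (mdifferentiableAt_diffeo g _) (mdifferentiableAt_diffeo f p.base)
    _ = ‖tangentImage f p‖ • tangentImage g (pushTangent f p) := by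
        rw [hvec]
        exact congrArg Subtype.val (map_smul (sphereDeriv g (f p.base)) _ _)

theorem logStretchUnit_trans (f g : SphereDiffeo) (p : UnitTangent) :
    logStretchUnit (f.trans g) p = logStretchUnit f p + logStretchUnit g (pushTangent f p) := by
  rw [logStretchUnit, tangentImage_trans, norm_smul, norm_norm,
    Real.log_mul (norm_ne_zero_iff.2 (tangentImage_ne_zero f p))
      (norm_ne_zero_iff.2 (tangentImage_ne_zero g _))]
  rfl

theorem pushTangent_trans (f g : SphereDiffeo) (p : UnitTangent) :
    pushTangent (f.trans g) p = pushTangent g (pushTangent f p) := by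
  refine unitTangent_ext ?_ ?_
  · simp only [base_pushTangent, Diffeomorph.coe_trans, Function.comp_apply]
  · rw [coe_pushTangent, coe_pushTangent, tangentImage_trans, norm_smul, norm_norm, mul_inv_rev,
      mul_smul, inv_smul_smul₀ (norm_ne_zero_iff.2 (tangentImage_ne_zero f p))]

theorem tangentImage_refl (p : UnitTangent) :
    tangentImage (Diffeomorph.refl (𝓡 2) S2 1) p = p.1.2 :=
  congrArg (fun T => (T p.vec : E3)) (sphereDeriv_id p.base)

theorem pushTangent_refl (p : UnitTangent) : pushTangent (Diffeomorph.refl (𝓡 2) S2 1) p = p := by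
  refine unitTangent_ext rfl ?_
  simp [coe_pushTangent, tangentImage_refl]

theorem pushTangent_iterComp (h : ℕ → SphereDiffeo) (p : UnitTangent) (n : ℕ) :
    pushTangent (iterComp h n) p = randomOrbit pushTangent p h n := by
  induction n with
  | zero => exact pushTangent_refl p
  | succ n ih => rw [iterComp, pushTangent_trans, ih, randomOrbit]

theorem logStretchUnit_iterComp (h : ℕ → SphereDiffeo) (p : UnitTangent) (n : ℕ) :
    logStretchUnit (iterComp h n) p =
      ∑ k ∈ Finset.range n, logStretchUnit (h k) (randomOrbit pushTangent p h k) := by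
  induction n with
  | zero => simp [logStretchUnit, iterComp, tangentImage_refl]
  | succ n ih =>
    rw [iterComp, logStretchUnit_trans, ih, pushTangent_iterComp, Finset.sum_range_succ]

/-! ### Measurability of the tangent cocycle -/

theorem contDiffOn_homExt_diffeo (f : SphereDiffeo) : ContDiffOn ℝ 1 (homExt f) {0}ᶜ := by
  obtain ⟨G, hGf, hG⟩ := contDiffAt_extension f
  exact contDiffOn_homExt hG hGf

theorem differentiableAt_homExt_diffeo (f : SphereDiffeo) (x : S2) :
    DifferentiableAt ℝ (homExt f) x :=
  ((contDiffOn_homExt_diffeo f).contDiffAt <|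
    isOpen_compl_singleton.mem_nhds (ne_zero_of_mem_unit_sphere x)).differentiableAt one_ne_zero

theorem coe_sphereDeriv_eq_fderiv_homExt (f : SphereDiffeo) (x : S2) (v : (ℝ ∙ (x : E3))ᗮ) :
    (sphereDeriv f x v : E3) = fderiv ℝ (homExt f) x v :=
  coe_sphereDeriv_of_extension (mdifferentiableAt_diffeo f x) (differentiableAt_homExt_diffeo f x)
    (homExt_coe f) v

theorem tangentImage_eq_fderiv_homExt (f : SphereDiffeo) (p : UnitTangent) :
    tangentImage f p = fderiv ℝ (homExt f) p.1.1 p.1.2 :=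
  coe_sphereDeriv_eq_fderiv_homExt f p.base p.vec

theorem continuous_fderiv_homExt_diffeo (f : SphereDiffeo) :
    Continuous fun x : S2 => fderiv ℝ (homExt f) x :=
  ((contDiffOn_homExt_diffeo f).continuousOn_fderiv_of_isOpen isOpen_compl_singleton
    le_rfl).comp_continuous continuous_subtype_val ne_zero_of_mem_unit_sphere

theorem continuous_tangentImage (f : SphereDiffeo) : Continuous (tangentImage f) := by
  rw [funext (tangentImage_eq_fderiv_homExt f)]
  have hbase : Continuous fun p : UnitTangent => p.1.1 := by fun_prop
  exact ((continuous_fderiv_homExt_diffeo f).comp hbase).clm_apply (by fun_prop)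

theorem continuous_jet (f : SphereDiffeo) : Continuous (jet f) :=
  (continuous_subtype_val.comp (f.continuous.comp
    (continuous_fst.comp continuous_subtype_val))).prodMk (continuous_tangentImage f)

theorem continuous_jet_apply (p : UnitTangent) : Continuous fun h : SphereDiffeo => jet h p :=
  (UniformFun.uniformContinuous_eval (E3 × E3) p).continuous.comp
    (continuous_induced_dom (f := fun h : SphereDiffeo => UniformFun.ofFun (jet h)))

theorem measurable_uncurry_jet :
    Measurable fun q : SphereDiffeo × UnitTangent => jet q.1 q.2 :=
  (measurable_uncurry_of_continuous_of_measurable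
    (u := fun p (h : SphereDiffeo) => jet h p) continuous_jet
    fun p => (continuous_jet_apply p).measurable).comp measurable_swap

theorem measurable_uncurry_pushTangent : Measurable (Function.uncurry pushTangent) := by
  have himage : Measurable fun q : SphereDiffeo × UnitTangent => tangentImage q.1 q.2 :=
    measurable_uncurry_jet.snd
  exact ((Measurable.subtype_mk (h := fun q => (q.1 q.2.base).2) measurable_uncurry_jet.fst).prodMk
    (himage.norm.inv.smul himage).subtype_mk).subtype_mk

theorem measurable_uncurry_logStretchUnit :
    Measurable fun q : SphereDiffeo × UnitTangent => logStretchUnit q.1 q.2 :=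
  measurable_uncurry_jet.snd.norm.log

theorem continuous_logStretchUnit (f : SphereDiffeo) : Continuous (logStretchUnit f) :=
  (continuous_tangentImage f).norm.log fun p => norm_ne_zero_iff.2 (tangentImage_ne_zero f p)

instance compactSpace_unitTangent : CompactSpace UnitTangent :=
  isCompact_iff_compactSpace.1 (isClosed_eq (by fun_prop) continuous_const).isCompact

theorem integrable_logStretchUnit (f : SphereDiffeo) (μ : Measure UnitTangent)
    [IsFiniteMeasure μ] : Integrable (logStretchUnit f) μ :=
  (continuous_logStretchUnit f).integrable_of_hasCompactSupport (.of_compactSpace _)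

/-! ### Oriented orthonormal frames -/

/-- The vector product of Euclidean three-space. -/
def cross (u v : E3) : E3 := WithLp.toLp 2 (crossProduct (WithLp.ofLp u) (WithLp.ofLp v))

theorem inner_eq_dotProduct (u v : E3) : ⟪u, v⟫ = dotProduct (WithLp.ofLp u) (WithLp.ofLp v) := by
  rw [EuclideanSpace.inner_eq_star_dotProduct, star_trivial, dotProduct_comm]

theorem inner_self_cross (u v : E3) : ⟪u, cross u v⟫ = 0 := by
  rw [inner_eq_dotProduct]
  exact dot_self_cross _ _

theorem inner_cross_self (u v : E3) : ⟪v, cross u v⟫ = 0 := by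
  rw [inner_eq_dotProduct]
  exact dot_cross_self _ _

theorem inner_cross_cross (u v w z : E3) :
    ⟪cross u v, cross w z⟫ = ⟪u, w⟫ * ⟪v, z⟫ - ⟪u, z⟫ * ⟪v, w⟫ := by
  simp only [inner_eq_dotProduct]
  exact cross_dot_cross _ _ _ _

theorem inner_cross_permutation (u v w : E3) : ⟪u, cross v w⟫ = ⟪v, cross w u⟫ := by
  simp only [inner_eq_dotProduct]
  exact triple_product_permutation _ _ _

theorem inner_cross_eq_det (u v w : E3) :
    ⟪u, cross v w⟫ = Matrix.det (Matrix.of ![WithLp.ofLp u, WithLp.ofLp v, WithLp.ofLp w]) := by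
  rw [inner_eq_dotProduct]
  exact triple_product_eq_det _ _ _

theorem cross_cross_self (u v : E3) : cross u (cross u v) = ⟪u, v⟫ • u - ⟪u, u⟫ • v := by
  simp only [inner_eq_dotProduct]
  exact congrArg (WithLp.toLp 2) (cross_cross_eq_smul_sub_smul' _ _ _)

theorem cross_add_smul (u v w : E3) (r s : ℝ) :
    cross u (r • v + s • w) = r • cross u v + s • cross u w := by
  simp [cross]

theorem orthonormal_vec3 {V : Type*} [NormedAddCommGroup V] [InnerProductSpace ℝ V] {u v w : V}
    (hu : ‖u‖ = 1) (hv : ‖v‖ = 1) (hw : ‖w‖ = 1) (huv : ⟪u, v⟫ = 0) (huw : ⟪u, w⟫ = 0)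
    (hvw : ⟪v, w⟫ = 0) : Orthonormal ℝ ![u, v, w] := by
  refine ⟨fun i => by fin_cases i <;> simp [hu, hv, hw], fun i j hij => ?_⟩
  fin_cases i <;> fin_cases j <;> first
    | exact absurd rfl hij
    | simp [huv, huw, hvw, real_inner_comm u, real_inner_comm v]

theorem norm_cross_of_inner_eq_zero {u v : E3} (hu : ‖u‖ = 1) (hv : ‖v‖ = 1) (huv : ⟪u, v⟫ = 0) :
    ‖cross u v‖ = 1 := by
  rw [norm_eq_sqrt_real_inner, inner_cross_cross, real_inner_self_eq_norm_sq,
    real_inner_self_eq_norm_sq, hu, hv, huv]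
  norm_num

/-- The positively oriented orthonormal basis `(x, v, x × v)` attached to a unit tangent vector
`v` at `x`. -/
def orthoFrame (p : UnitTangent) : OrthonormalBasis (Fin 3) ℝ E3 :=
  have horth : Orthonormal ℝ ![(p.1.1 : E3), (p.1.2 : E3), cross p.1.1 p.1.2] :=
    orthonormal_vec3 (norm_eq_of_mem_sphere _) (norm_eq_of_mem_sphere _)
      (norm_cross_of_inner_eq_zero (norm_eq_of_mem_sphere _) (norm_eq_of_mem_sphere _) p.2) p.2
      (inner_self_cross _ _) (inner_cross_self _ _)
  (basisOfOrthonormalOfCardEqFinrank horth (by simp)).toOrthonormalBasis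
    (by rwa [coe_basisOfOrthonormalOfCardEqFinrank])

theorem coe_orthoFrame (p : UnitTangent) :
    ⇑(orthoFrame p) = ![(p.1.1 : E3), (p.1.2 : E3), cross p.1.1 p.1.2] := by
  simp [orthoFrame]

theorem unitVec_zero (x : S2) : unitVec x 0 = frameFst x := by simp [unitVec]

theorem unitVec_pi_div_two (x : S2) : unitVec x (Real.pi / 2) = frameSnd x := by simp [unitVec]

theorem coe_orthoFrame_unitTangentOf_zero (x : S2) :
    ⇑(orthoFrame (unitTangentOf (x, 0))) = ![(x : E3), frameFst x, frameSnd x] := by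
  rw [coe_orthoFrame]
  simp only [unitTangentOf, unitVec_zero]
  rfl

theorem exists_unitVec_eq (x : S2) {v : E3} (hv : ‖v‖ = 1) (hxv : ⟪(x : E3), v⟫ = 0) :
    ∃ θ : ℝ, unitVec x θ = v := by
  set b := orthoFrame (unitTangentOf (x, 0)) with hb
  have hdecomp : ⟪frameFst x, v⟫ • frameFst x + ⟪frameSnd x, v⟫ • frameSnd x = v := by
    simpa [Fin.sum_univ_three, hb, coe_orthoFrame_unitTangentOf_zero, hxv] using b.sum_repr' v
  have hcircle : ⟪frameFst x, v⟫ ^ 2 + ⟪frameSnd x, v⟫ ^ 2 = 1 := by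
    simpa [Fin.sum_univ_three, hb, coe_orthoFrame_unitTangentOf_zero, hxv, hv]
      using b.sum_sq_norm_inner_right v
  set z : ℂ := ⟨⟪frameFst x, v⟫, ⟪frameSnd x, v⟫⟩
  have hz : ‖z‖ = 1 := by
    rw [← sq_eq_sq₀ (norm_nonneg _) zero_le_one, Complex.sq_norm, Complex.normSq_apply, ← sq, ← sq,
      hcircle, one_pow]
  refine ⟨z.arg, ?_⟩
  rw [unitVec, ← one_mul (Real.cos _), ← one_mul (Real.sin _), ← hz, Complex.norm_mul_cos_arg,
    Complex.norm_mul_sin_arg]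
  exact hdecomp

theorem cross_unitVec (x : S2) (θ : ℝ) :
    cross x (unitVec x θ) = Real.cos θ • frameSnd x - Real.sin θ • frameFst x := by
  have hx : ⟪(x : E3), (x : E3)⟫ = 1 := by simp
  have horth : ⟪(x : E3), frameFst x⟫ = 0 := unitVec_zero x ▸ inner_unitVec x 0
  calc cross x (unitVec x θ)
      = Real.cos θ • cross x (frameFst x) + Real.sin θ • cross x (cross x (frameFst x)) :=
        cross_add_smul _ _ _ _ _
    _ = Real.cos θ • frameSnd x - Real.sin θ • frameFst x := by
        rw [cross_cross_self, hx, horth, zero_smul, zero_sub, one_smul, smul_neg, ← sub_eq_add_neg]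
        rfl

/-! ### The action of rotations on unit tangent vectors -/

/-- A rotation as a linear isometry of Euclidean three-space. -/
def rotIso (g : SO3) : E3 ≃ₗᵢ[ℝ] E3 where
  toFun := rotLin g
  invFun := rotLin g⁻¹
  map_add' := map_add _
  map_smul' := map_smul _
  left_inv y := by rw [← rotLin_mul, inv_mul_cancel, rotLin_one]
  right_inv y := by rw [← rotLin_mul, mul_inv_cancel, rotLin_one]
  norm_map' := norm_rotLin g

theorem inner_rotLin (g : SO3) (u v : E3) : ⟪rotLin g u, rotLin g v⟫ = ⟪u, v⟫ :=
  (rotIso g).inner_map_map u v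

theorem ofLp_rotLin (g : SO3) (u : E3) :
    WithLp.ofLp (rotLin g u) = Matrix.mulVec (g : Matrix (Fin 3) (Fin 3) ℝ) (WithLp.ofLp u) :=
  Matrix.ofLp_toEuclideanCLM _ _

theorem inner_rotLin_cross (g : SO3) (u v w : E3) :
    ⟪rotLin g u, cross (rotLin g v) (rotLin g w)⟫ = ⟪u, cross v w⟫ := by
  have hdet : (g : Matrix (Fin 3) (Fin 3) ℝ).det = 1 :=
    (Matrix.mem_specialOrthogonalGroup_iff.1 g.2).2
  have hrows : Matrix.of ![WithLp.ofLp (rotLin g u), WithLp.ofLp (rotLin g v),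
      WithLp.ofLp (rotLin g w)] =
      Matrix.of ![WithLp.ofLp u, WithLp.ofLp v, WithLp.ofLp w] *
        (g : Matrix (Fin 3) (Fin 3) ℝ).transpose := by
    ext i j
    fin_cases i <;> simp [ofLp_rotLin, Matrix.mulVec, Matrix.mul_apply, dotProduct, mul_comm]
  rw [inner_cross_eq_det, inner_cross_eq_det, hrows, Matrix.det_mul, Matrix.det_transpose, hdet,
    mul_one]

theorem rotLin_cross (g : SO3) (u v : E3) :
    rotLin g (cross u v) = cross (rotLin g u) (rotLin g v) := by
  refine ext_inner_left ℝ fun w => ?_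
  obtain ⟨w, rfl⟩ := (rotIso g).surjective w
  exact (inner_rotLin g w _).trans (inner_rotLin_cross g w u v).symm

instance : MulAction SO3 UnitTangent where
  smul g p := ⟨(rotFun g p.1.1, rotFun g p.1.2), (inner_rotLin g _ _).trans p.2⟩
  one_smul _ := unitTangent_ext (Subtype.ext (rotLin_one _)) (rotLin_one _)
  mul_smul g k _ := unitTangent_ext (Subtype.ext (rotLin_mul g k _)) (rotLin_mul g k _)

theorem base_smul_unitTangent (g : SO3) (p : UnitTangent) : (g • p).1.1 = rotFun g p.1.1 := rfl

theorem coe_smul_unitTangent (g : SO3) (p : UnitTangent) :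
    ((g • p).1.2 : E3) = rotLin g p.1.2 := rfl

theorem continuous_rotLin_apply : Continuous fun q : SO3 × E3 => rotLin q.1 q.2 := by
  have hrot : Continuous rotLin :=
    (LinearMap.continuous_of_finiteDimensional
      (Matrix.toEuclideanCLM (n := Fin 3) (𝕜 := ℝ)).toAlgEquiv.toLinearMap).comp
      continuous_subtype_val
  exact (hrot.comp continuous_fst).clm_apply continuous_snd

instance : ContinuousSMul SO3 UnitTangent where
  continuous_smul := by
    have hbase : Continuous fun q : SO3 × UnitTangent => rotLin q.1 (q.2.1.1 : E3) :=
      continuous_rotLin_apply.comp₂ continuous_fst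
        (by fun_prop : Continuous fun q : SO3 × UnitTangent => (q.2.1.1 : E3))
    have hvec : Continuous fun q : SO3 × UnitTangent => rotLin q.1 (q.2.1.2 : E3) :=
      continuous_rotLin_apply.comp₂ continuous_fst
        (by fun_prop : Continuous fun q : SO3 × UnitTangent => (q.2.1.2 : E3))
    exact ((hbase.subtype_mk _).prodMk (hvec.subtype_mk _)).subtype_mk _

theorem det_toMatrix_orthoFrame (p : UnitTangent) :
    ((EuclideanSpace.basisFun (Fin 3) ℝ).toBasis.toMatrix (orthoFrame p)).det = 1 := by
  have hrows : ((EuclideanSpace.basisFun (Fin 3) ℝ).toBasis.toMatrix (orthoFrame p)).transpose =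
      Matrix.of ![WithLp.ofLp (p.1.1 : E3), WithLp.ofLp (p.1.2 : E3),
        WithLp.ofLp (cross p.1.1 p.1.2)] := by
    ext i j
    fin_cases i <;> simp [Module.Basis.toMatrix_apply, coe_orthoFrame]
  rw [← Matrix.det_transpose, hrows, ← inner_cross_eq_det, inner_cross_permutation,
    inner_cross_permutation, real_inner_self_eq_norm_sq,
    norm_cross_of_inner_eq_zero (norm_eq_of_mem_sphere _) (norm_eq_of_mem_sphere _) p.2, one_pow]

/-- The rotation that takes the standard basis to the frame of a unit tangent vector. -/
def frameRotation (p : UnitTangent) : SO3 :=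
  ⟨(EuclideanSpace.basisFun (Fin 3) ℝ).toBasis.toMatrix (orthoFrame p),
    Matrix.mem_specialOrthogonalGroup_iff.2
      ⟨OrthonormalBasis.toMatrix_orthonormalBasis_mem_unitary _ _, det_toMatrix_orthoFrame p⟩⟩

theorem rotLin_frameRotation_single (p : UnitTangent) (i : Fin 3) :
    rotLin (frameRotation p) (EuclideanSpace.single i 1) = orthoFrame p i := by
  ext j
  rw [ofLp_rotLin]
  simp [frameRotation, Module.Basis.toMatrix_apply]

instance : MulAction.IsPretransitive SO3 UnitTangent := by
  let p₀ : UnitTangent :=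
    ⟨(⟨EuclideanSpace.single 0 1, by simp⟩, ⟨EuclideanSpace.single 1 1, by simp⟩), by
      simp [EuclideanSpace.inner_single_left]⟩
  refine (MulAction.isPretransitive_iff_base p₀).2 fun p => ⟨frameRotation p, ?_⟩
  refine unitTangent_ext (Subtype.ext ?_) ?_
  · exact (rotLin_frameRotation_single p 0).trans (by simp [coe_orthoFrame])
  · exact (rotLin_frameRotation_single p 1).trans (by simp [coe_orthoFrame])

theorem exists_smul_unitTangentOf (g : SO3) (x : S2) :
    ∃ α : ℝ, ∀ θ : ℝ, g • unitTangentOf (x, θ) = unitTangentOf (rotFun g x, α + θ) := by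
  have hunit : ‖rotLin g (frameFst x)‖ = 1 := by
    rw [norm_rotLin, ← unitVec_zero]
    exact norm_eq_of_mem_sphere ⟨_, unitVec_mem x 0⟩
  have horth : ⟪(rotFun g x : E3), rotLin g (frameFst x)⟫ = 0 :=
    (inner_rotLin g _ _).trans (unitVec_zero x ▸ inner_unitVec x 0)
  obtain ⟨α, hα⟩ := exists_unitVec_eq (rotFun g x) hunit horth
  refine ⟨α, fun θ => unitTangent_ext rfl ?_⟩
  have hsnd : rotLin g (frameSnd x) =
      Real.cos α • frameSnd (rotFun g x) - Real.sin α • frameFst (rotFun g x) := by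
    rw [← cross_unitVec, hα]
    exact rotLin_cross g _ _
  calc rotLin g (unitVec x θ)
      = Real.cos θ • unitVec (rotFun g x) α + Real.sin θ • rotLin g (frameSnd x) := by
        rw [unitVec, map_add, map_smul, map_smul, hα]
    _ = unitVec (rotFun g x) (α + θ) := by
        rw [hsnd, unitVec, unitVec, Real.cos_add, Real.sin_add]
        module

theorem tangentImage_trans_rot (f : SphereDiffeo) (g : SO3) (p : UnitTangent) :
    tangentImage (f.trans (rot g)) p = rotLin g (tangentImage f p) :=
  coe_sphereDeriv_rot_comp f g p.base p.vec

theorem pushTangent_trans_rot (f : SphereDiffeo) (g : SO3) (p : UnitTangent) :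
    pushTangent (f.trans (rot g)) p = g • pushTangent f p := by
  refine unitTangent_ext ?_ ?_
  · rw [base_pushTangent, base_smul_unitTangent, base_pushTangent]
    rfl
  · rw [coe_pushTangent, coe_smul_unitTangent, coe_pushTangent, tangentImage_trans_rot,
      norm_rotLin, map_smul]

/-! ### Rotation invariance of area and of Liouville measure -/

open scoped Pointwise in
theorem measurePreserving_toSphere_of_linearIsometryEquiv {V : Type*} [NormedAddCommGroup V]
    [InnerProductSpace ℝ V] [FiniteDimensional ℝ V] [MeasurableSpace V] [BorelSpace V]
    (L : V ≃ₗᵢ[ℝ] V) {f : Metric.sphere (0 : V) 1 → Metric.sphere (0 : V) 1} (hf : Measurable f)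
    (hL : ∀ x : Metric.sphere (0 : V) 1, L x = f x) :
    MeasurePreserving f (volume : Measure V).toSphere (volume : Measure V).toSphere := by
  refine ⟨hf, Measure.ext fun s hs => ?_⟩
  have hpre : ((↑) '' (f ⁻¹' s) : Set V) = L ⁻¹' ((↑) '' s) := by
    ext y
    constructor
    · rintro ⟨x, hx, rfl⟩
      exact ⟨f x, hx, (hL x).symm⟩
    · rintro ⟨z, hz, hzy⟩
      have hy : y ∈ Metric.sphere (0 : V) 1 := by
        rw [mem_sphere_zero_iff_norm, ← L.norm_map, ← hzy, norm_eq_of_mem_sphere]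
      have hfy : f ⟨y, hy⟩ = z := Subtype.ext ((hL ⟨y, hy⟩).symm.trans hzy.symm)
      exact ⟨⟨y, hy⟩, show f ⟨y, hy⟩ ∈ s from hfy ▸ hz, rfl⟩
  have hcone (A : Set V) : Ioo (0 : ℝ) 1 • L ⁻¹' A = L ⁻¹' (Ioo (0 : ℝ) 1 • A) := by
    ext y
    constructor
    · rintro ⟨r, hr, z, hz, rfl⟩
      exact ⟨r, hr, L z, hz, (L.map_smul r z).symm⟩
    · rintro ⟨r, hr, z, hz, hzy⟩
      exact ⟨r, hr, L.symm z, by simpa using hz, L.injective (by simpa using hzy)⟩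
  rw [Measure.map_apply hf hs, Measure.toSphere_apply' _ hs, Measure.toSphere_apply' _ (hf hs),
    hpre, hcone]
  congr 1
  exact L.measurePreserving.measure_preimage_equiv (f := L.toHomeomorph.toMeasurableEquiv) _

theorem area_eq_smul_toSphere :
    area = ((volume : Measure E3).toSphere univ)⁻¹ • (volume : Measure E3).toSphere := by
  simp [area, ProbabilityTheory.cond]

theorem toSphere_univ_ne_zero : (volume : Measure E3).toSphere univ ≠ 0 :=
  Measure.measure_univ_ne_zero.2 (Measure.toSphere_ne_zero _)

instance : IsProbabilityMeasure area :=
  ProbabilityTheory.cond_isProbabilityMeasure toSphere_univ_ne_zero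

theorem measurePreserving_area_rotFun (g : SO3) : MeasurePreserving (rotFun g) area area := by
  rw [area_eq_smul_toSphere]
  exact (measurePreserving_toSphere_of_linearIsometryEquiv (rotIso g)
    (rot g).continuous.measurable fun _ => rfl).smul_measure _

theorem measurable_frameFst : Measurable frameFst := by
  have hcoord (i : Fin 3) : Measurable fun x : S2 => (x : E3) i :=
    (by fun_prop : Continuous fun x : S2 => (x : E3) i).measurable
  have heast : Measurable fun x : S2 => (!₂[-(x : E3) 1, (x : E3) 0, 0] : E3) := by
    refine (WithLp.measurable_toLp 2 _).comp (measurable_pi_lambda _ fun i => ?_)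
    fin_cases i
    · exact (hcoord 1).neg
    · exact hcoord 0
    · exact measurable_const
  have hradius : Measurable fun x : S2 => (x : E3) 0 ^ 2 + (x : E3) 1 ^ 2 :=
    ((hcoord 0).pow_const 2).add ((hcoord 1).pow_const 2)
  exact Measurable.ite (measurableSet_eq_fun hradius measurable_const) measurable_const
    (hradius.sqrt.inv.smul heast)

theorem continuous_cross : Continuous fun q : E3 × E3 => cross q.1 q.2 := by
  simp only [cross, cross_apply]
  fun_prop

theorem measurable_unitTangentOf : Measurable unitTangentOf := by
  have hsnd : Measurable frameSnd :=
    continuous_cross.measurable.comp (measurable_subtype_coe.prodMk measurable_frameFst)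
  have hvec : Measurable fun q : S2 × ℝ => unitVec q.1 q.2 :=
    ((Real.measurable_cos.comp measurable_snd).smul (measurable_frameFst.comp measurable_fst)).add
      ((Real.measurable_sin.comp measurable_snd).smul (hsnd.comp measurable_fst))
  exact (measurable_fst.prodMk hvec.subtype_mk).subtype_mk

theorem liouvilleUnit_eq_map : liouvilleUnit = (area.prod angleMeasure).map unitTangentOf := rfl

instance : IsProbabilityMeasure liouvilleUnit := by
  rw [liouvilleUnit_eq_map]
  exact Measure.isProbabilityMeasure_map measurable_unitTangentOf.aemeasurable

theorem lintegral_liouvilleUnit {φ : UnitTangent → ENNReal} (hφ : Measurable φ) :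
    ∫⁻ p, φ p ∂liouvilleUnit = ∫⁻ x, ∫⁻ θ, φ (unitTangentOf (x, θ)) ∂angleMeasure ∂area := by
  rw [liouvilleUnit_eq_map, lintegral_map hφ measurable_unitTangentOf]
  exact lintegral_prod _ (hφ.comp measurable_unitTangentOf).aemeasurable

theorem periodic_unitTangentOf (x : S2) :
    Function.Periodic (fun θ => unitTangentOf (x, θ)) (2 * Real.pi) := fun θ =>
  unitTangent_ext rfl (by simp [unitTangentOf, unitVec])

instance : SMulInvariantMeasure SO3 UnitTangent liouvilleUnit := by
  refine ((smulInvariantMeasure_tfae SO3 liouvilleUnit).out 0 5).2 fun g => ?_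
  refine Measure.ext_of_lintegral _ fun φ hφ => ?_
  have hφg : Measurable fun p : UnitTangent => φ (g • p) := hφ.comp (measurable_const_smul g)
  have hfibre (x : S2) : ∫⁻ θ, φ (g • unitTangentOf (x, θ)) ∂angleMeasure =
      ∫⁻ θ, φ (unitTangentOf (rotFun g x, θ)) ∂angleMeasure := by
    obtain ⟨α, hα⟩ := exists_smul_unitTangentOf g x
    simp only [hα]
    exact lintegral_angleMeasure_add ((periodic_unitTangentOf _).comp φ) α
  calc ∫⁻ p, φ p ∂liouvilleUnit.map (g • ·)
      = ∫⁻ p, φ (g • p) ∂liouvilleUnit := lintegral_map hφ (measurable_const_smul g)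
    _ = ∫⁻ x, ∫⁻ θ, φ (unitTangentOf (rotFun g x, θ)) ∂angleMeasure ∂area := by
        simp only [lintegral_liouvilleUnit hφg, hfibre]
    _ = ∫⁻ x, ∫⁻ θ, φ (unitTangentOf (x, θ)) ∂angleMeasure ∂area :=
        (measurePreserving_area_rotFun g).lintegral_comp
          (hφ.comp measurable_unitTangentOf).lintegral_prod_right'
    _ = ∫⁻ p, φ p ∂liouvilleUnit := (lintegral_liouvilleUnit hφ).symm

theorem map_pushTangent_cosetMeasure (f : SphereDiffeo) (p : UnitTangent) :
    (cosetMeasure f).map (pushTangent · p) = liouvilleUnit := by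
  have : haarSO3.IsHaarMeasure := by unfold haarSO3; infer_instance
  have := isMulRightInvariant_of_isHaarMeasure haarSO3
  have hpush : Measurable fun h : SphereDiffeo => pushTangent h p :=
    measurable_uncurry_pushTangent.of_uncurry_right
  rw [cosetMeasure, Measure.map_map hpush (continuous_coset f).measurable]
  simp only [Function.comp_def, pushTangent_trans_rot]
  exact map_smul_const_eq_of_smulInvariantMeasure haarSO3 liouvilleUnit (pushTangent f p)

/-! ### The random exponent -/

theorem ae_logStretchUnit_cosetMeasure (f : SphereDiffeo) :
    ∀ᵐ h ∂cosetMeasure f, ∀ p, logStretchUnit h p = logStretchUnit f p := by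
  have hclosed : IsClosed {h : SphereDiffeo | ∀ p, ‖tangentImage h p‖ = ‖tangentImage f p‖} := by
    simp only [ofPred_forall]
    exact isClosed_iInter fun p => isClosed_eq (continuous_jet_apply p).snd.norm continuous_const
  have hnorm : ∀ᵐ h ∂cosetMeasure f, ∀ p, ‖tangentImage h p‖ = ‖tangentImage f p‖ :=
    (ae_map_iff (continuous_coset f).measurable.aemeasurable hclosed.measurableSet).2 <|
      Eventually.of_forall fun g p => by rw [tangentImage_trans_rot, norm_rotLin]
  filter_upwards [hnorm] with h hh p using congrArg Real.log (hh p)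

theorem ae_tendsto_logStretchUnit_iterComp (f : SphereDiffeo) (p : UnitTangent) :
    ∀ᵐ h ∂Measure.infinitePi fun _ : ℕ => cosetMeasure f,
      Tendsto (fun n : ℕ => (1 / (n : ℝ)) * logStretchUnit (iterComp h n) p) atTop
        (𝓝 (∫ q, logStretchUnit f q ∂liouvilleUnit)) := by
  have hstretch : ∀ᵐ h ∂Measure.infinitePi fun _ : ℕ => cosetMeasure f,
      ∀ k q, logStretchUnit (h k) q = logStretchUnit f q :=
    ae_all_iff.2 fun k => (measurePreserving_eval_infinitePi (fun _ => cosetMeasure f)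
      k).quasiMeasurePreserving.ae (ae_logStretchUnit_cosetMeasure f)
  filter_upwards [hstretch, ae_tendsto_average_randomOrbit measurable_uncurry_pushTangent
    (map_pushTangent_cosetMeasure f) (continuous_logStretchUnit f).measurable
    (integrable_logStretchUnit f _) p] with h hh hlim
  simpa only [logStretchUnit_iterComp, hh, one_div_mul_eq_div] using hlim

theorem measurable_logStretchUnit_iterComp (n : ℕ) :
    Measurable fun q : UnitTangent × (ℕ → SphereDiffeo) =>
      logStretchUnit (iterComp q.2 n) q.1 := by
  simp only [logStretchUnit_iterComp]
  refine Finset.measurable_fun_sum _ fun k _ => ?_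
  have hstretch := measurable_uncurry_logStretchUnit.comp
    (((measurable_pi_apply k).comp measurable_snd).prodMk
      (measurable_randomOrbit measurable_uncurry_pushTangent k))
  exact hstretch

theorem ae_ae_tendsto_logStretchUnit_iterComp (f : SphereDiffeo) {X : Type*} [MeasurableSpace X]
    (μ : Measure X) [SFinite μ] {σ : X → UnitTangent} (hσ : Measurable σ) :
    ∀ᵐ h ∂Measure.infinitePi fun _ : ℕ => cosetMeasure f, ∀ᵐ x ∂μ,
      Tendsto (fun n : ℕ => (1 / (n : ℝ)) * logStretchUnit (iterComp h n) (σ x)) atTop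
        (𝓝 (∫ q, logStretchUnit f q ∂liouvilleUnit)) := by
  refine (Measure.ae_ae_comm (μ := μ) (measurableSet_tendsto _ fun n => ?_)).1
    (Eventually.of_forall fun x => ae_tendsto_logStretchUnit_iterComp f (σ x))
  exact ((measurable_logStretchUnit_iterComp n).comp
    ((hσ.comp measurable_fst).prodMk measurable_snd)).const_mul _

theorem tangentImage_unitTangentOf (f : SphereDiffeo) (x : S2) (θ : ℝ) :
    tangentImage f (unitTangentOf (x, θ)) =
      Real.cos θ • tangentImage f (unitTangentOf (x, 0)) +
        Real.sin θ • tangentImage f (unitTangentOf (x, Real.pi / 2)) := by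
  simp only [tangentImage_eq_fderiv_homExt, unitTangentOf]
  rw [unitVec_zero, unitVec_pi_div_two, ← map_smul, ← map_smul, ← map_add, unitVec]

theorem norm_tangentImage_le (f : SphereDiffeo) (p : UnitTangent) :
    ‖tangentImage f p‖ ≤ ‖sphereDeriv f p.base‖ := by
  have hvec : ‖p.vec‖ = 1 := norm_eq_of_mem_sphere p.1.2
  exact ((sphereDeriv f p.base).le_opNorm p.vec).trans_eq (by rw [hvec, mul_one])

theorem norm_sphereDeriv_le (f : SphereDiffeo) (x : S2) :
    ‖sphereDeriv f x‖ ≤ ‖tangentImage f (unitTangentOf (x, 0))‖ +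
      ‖tangentImage f (unitTangentOf (x, Real.pi / 2))‖ := by
  refine ContinuousLinearMap.opNorm_le_of_unit_norm (by positivity) fun v hv => ?_
  obtain ⟨θ, hθ : unitVec x θ = v⟩ :=
    exists_unitVec_eq x hv (Submodule.mem_orthogonal_singleton_iff_inner_right.1 v.2)
  calc ‖sphereDeriv f x v‖ = ‖tangentImage f (unitTangentOf (x, θ))‖ := by
        rw [tangentImage_eq_fderiv_homExt, Submodule.coe_norm, coe_sphereDeriv_eq_fderiv_homExt,
          ← hθ]
        rfl
    _ ≤ _ := by
        rw [tangentImage_unitTangentOf]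
        refine norm_add_le_of_le ?_ ?_
        · rw [norm_smul]
          exact mul_le_of_le_one_left (norm_nonneg _) (Real.abs_cos_le_one θ)
        · rw [norm_smul]
          exact mul_le_of_le_one_left (norm_nonneg _) (Real.abs_sin_le_one θ)

theorem tendsto_one_div_mul_log_of_le_of_le_add {u v w : ℕ → ℝ} {R : ℝ} (hu : ∀ n, 0 < u n)
    (huv : ∀ n, u n ≤ v n) (hvuw : ∀ n, v n ≤ u n + w n)
    (hulim : Tendsto (fun n : ℕ => (1 / (n : ℝ)) * Real.log (u n)) atTop (𝓝 R))
    (hwlim : Tendsto (fun n : ℕ => (1 / (n : ℝ)) * Real.log (w n)) atTop (𝓝 R)) :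
    Tendsto (fun n : ℕ => (1 / (n : ℝ)) * Real.log (v n)) atTop (𝓝 R) := by
  have hupper : Tendsto (fun n : ℕ => (1 / (n : ℝ)) * Real.log 2 +
      max ((1 / (n : ℝ)) * Real.log (u n)) ((1 / (n : ℝ)) * Real.log (w n))) atTop (𝓝 R) := by
    simpa using (tendsto_one_div_atTop_nhds_zero_nat.mul_const (Real.log 2)).add (hulim.max hwlim)
  refine tendsto_of_tendsto_of_tendsto_of_le_of_le hulim hupper (fun n => ?_) fun n => ?_
  · exact mul_le_mul_of_nonneg_left (Real.log_le_log (hu n) (huv n)) (by positivity)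
  · have hmax : 0 < max (u n) (w n) := lt_max_of_lt_left (hu n)
    have hlog : Real.log (v n) ≤ Real.log 2 + max (Real.log (u n)) (Real.log (w n)) :=
      calc Real.log (v n) ≤ Real.log (2 * max (u n) (w n)) :=
            Real.log_le_log ((hu n).trans_le (huv n)) <| (hvuw n).trans <| by
              linarith [le_max_left (u n) (w n), le_max_right (u n) (w n)]
        _ = Real.log 2 + Real.log (max (u n) (w n)) := Real.log_mul two_ne_zero hmax.ne'
        _ ≤ Real.log 2 + max (Real.log (u n)) (Real.log (w n)) := by
            rcases max_choice (u n) (w n) with h | h <;> rw [h] <;> simp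
    have hn : 0 ≤ 1 / (n : ℝ) := by positivity
    simpa only [mul_add, mul_max_of_nonneg _ _ hn] using mul_le_mul_of_nonneg_left hlog hn

theorem hasRandomExponent_cosetMeasure (f : SphereDiffeo) :
    HasRandomExponent (cosetMeasure f) (∫ p, logStretchUnit f p ∂liouvilleUnit) := by
  have hsection (θ : ℝ) : Measurable fun x => unitTangentOf (x, θ) :=
    measurable_unitTangentOf.comp measurable_prodMk_right
  filter_upwards [ae_ae_tendsto_logStretchUnit_iterComp f area (hsection 0),
    ae_ae_tendsto_logStretchUnit_iterComp f area (hsection (Real.pi / 2))] with h hfst hsnd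
  refine ⟨fun _ => ∫ p, logStretchUnit f p ∂liouvilleUnit, ?_, integrable_const _, by simp⟩
  filter_upwards [hfst, hsnd] with x hxfst hxsnd
  exact tendsto_one_div_mul_log_of_le_of_le_add
    (fun n => norm_pos_iff.2 (tangentImage_ne_zero _ _))
    (fun n => norm_tangentImage_le _ (unitTangentOf (x, 0)))
    (fun n => norm_sphereDeriv_le _ x) hxfst hxsnd

/-! ### Positivity -/

instance : area.IsOpenPosMeasure := by
  rw [area_eq_smul_toSphere]
  refine ⟨fun U hU hne => ?_⟩
  rw [Measure.smul_apply, smul_eq_mul]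
  exact mul_ne_zero (ENNReal.inv_ne_zero.2 (measure_ne_top _ _)) (hU.measure_ne_zero _ hne)

theorem measurePreserving_toSphere_of_area {f : S2 → S2} (hf : MeasurePreserving f area area) :
    MeasurePreserving f (volume : Measure E3).toSphere (volume : Measure E3).toSphere := by
  have htoSphere : (volume : Measure E3).toSphere =
      (volume : Measure E3).toSphere univ • area := by
    rw [area_eq_smul_toSphere, smul_smul,
      ENNReal.mul_inv_cancel toSphere_univ_ne_zero (measure_ne_top _ _), one_smul]
  rw [htoSphere]
  exact hf.smul_measure _

theorem fderiv_homExt_comp_orthoFrame (f : SphereDiffeo) (x : S2) :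
    fderiv ℝ (homExt f) x ∘ orthoFrame (unitTangentOf (x, 0)) =
      ![(f x : E3), tangentImage f (unitTangentOf (x, 0)),
        tangentImage f (unitTangentOf (x, Real.pi / 2))] := by
  rw [coe_orthoFrame_unitTangentOf_zero]
  ext1 i
  fin_cases i <;>
    simp [tangentImage_eq_fderiv_homExt, unitTangentOf, unitVec_zero, unitVec_pi_div_two,
      fderiv_homExt_coe_self (differentiableAt_homExt_diffeo f x)]

theorem gram_tangentImage {f : SphereDiffeo} (hf : MeasurePreserving f area area) (x : S2) :
    ‖tangentImage f (unitTangentOf (x, 0))‖ ^ 2 *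
        ‖tangentImage f (unitTangentOf (x, Real.pi / 2))‖ ^ 2 -
      ⟪tangentImage f (unitTangentOf (x, 0)),
        tangentImage f (unitTangentOf (x, Real.pi / 2))⟫ ^ 2 = 1 := by
  have habs : |LinearMap.det (fderiv ℝ (homExt f) x : E3 →ₗ[ℝ] E3)| = 1 :=
    abs_det_fderiv_homExt_eq_one f.toHomeomorph.toMeasurableEquiv
      (measurePreserving_toSphere_of_area hf) (contDiffOn_homExt_diffeo f) x
  have hdet : (Matrix.gram ℝ ![(f x : E3), tangentImage f (unitTangentOf (x, 0)),
      tangentImage f (unitTangentOf (x, Real.pi / 2))]).det = 1 := by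
    rw [← fderiv_homExt_comp_orthoFrame]
    exact (det_sq_eq_det_gram (orthoFrame (unitTangentOf (x, 0)))
      (fderiv ℝ (homExt f) x : E3 →ₗ[ℝ] E3)).symm.trans (by rw [← sq_abs, habs, one_pow])
  have hfst : ⟪(f x : E3), tangentImage f (unitTangentOf (x, 0))⟫ = 0 := inner_tangentImage f _
  have hsnd : ⟪(f x : E3), tangentImage f (unitTangentOf (x, Real.pi / 2))⟫ = 0 :=
    inner_tangentImage f _
  rw [← hdet, Matrix.det_fin_three]
  simp [Matrix.gram_apply, hfst, hsnd, real_inner_comm (f x : E3), sq,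
    real_inner_comm (tangentImage f (unitTangentOf (x, 0)))]

theorem norm_fderiv_homExt_eq_of_orthonormal {f : SphereDiffeo} {x : S2}
    (hfst : ‖tangentImage f (unitTangentOf (x, 0))‖ = 1)
    (hsnd : ‖tangentImage f (unitTangentOf (x, Real.pi / 2))‖ = 1)
    (horth : ⟪tangentImage f (unitTangentOf (x, 0)),
      tangentImage f (unitTangentOf (x, Real.pi / 2))⟫ = 0) (v : E3) :
    ‖fderiv ℝ (homExt f) x v‖ = ‖v‖ := by
  have himage : Orthonormal ℝ
      (fderiv ℝ (homExt f) x ∘ (orthoFrame (unitTangentOf (x, 0))).toBasis) := by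
    rw [OrthonormalBasis.coe_toBasis, fderiv_homExt_comp_orthoFrame]
    exact orthonormal_vec3 (norm_eq_of_mem_sphere _) hfst hsnd (inner_tangentImage f _)
      (inner_tangentImage f _) horth
  exact ((fderiv ℝ (homExt f) x : E3 →ₗ[ℝ] E3).isometryOfOrthonormal
    (v := (orthoFrame (unitTangentOf (x, 0))).toBasis)
    (by simp) himage).norm_map v

theorem isometry_of_ae_norm_fderiv_homExt_eq {f : SphereDiffeo}
    (h : ∀ᵐ x : S2 ∂area, ∀ v : E3, ‖fderiv ℝ (homExt f) x v‖ = ‖v‖) : Isometry f := by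
  have hclosed : IsClosed {x : S2 | ∀ v : E3, ‖fderiv ℝ (homExt f) x v‖ = ‖v‖} := by
    simp only [ofPred_forall]
    exact isClosed_iInter fun v => isClosed_eq
      ((continuous_fderiv_homExt_diffeo f).clm_apply continuous_const).norm continuous_const
  have hall : {x : S2 | ∀ v : E3, ‖fderiv ℝ (homExt f) x v‖ = ‖v‖} = univ :=
    hclosed.closure_eq.symm.trans (Measure.dense_of_ae h).closure_eq
  exact isometry_of_norm_fderiv_homExt_eq f.toEquiv
    ((contDiffOn_homExt_diffeo f).differentiableOn one_ne_zero)
    ((contDiffOn_homExt_diffeo f.symm).differentiableOn one_ne_zero) (eq_univ_iff_forall.1 hall)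

theorem integrable_logStretchUnit_unitTangentOf (f : SphereDiffeo) :
    Integrable (fun q => logStretchUnit f (unitTangentOf q)) (area.prod angleMeasure) :=
  (integrable_logStretchUnit f liouvilleUnit).comp_measurable measurable_unitTangentOf

theorem integral_logStretchUnit (f : SphereDiffeo) :
    ∫ p, logStretchUnit f p ∂liouvilleUnit =
      ∫ x, ∫ θ, logStretchUnit f (unitTangentOf (x, θ)) ∂angleMeasure ∂area := by
  rw [liouvilleUnit_eq_map, integral_map measurable_unitTangentOf.aemeasurable
    (continuous_logStretchUnit f).measurable.aestronglyMeasurable]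
  exact integral_prod _ (integrable_logStretchUnit_unitTangentOf f)

theorem integral_logStretchUnit_unitTangentOf (f : SphereDiffeo) (x : S2) :
    ∫ θ, logStretchUnit f (unitTangentOf (x, θ)) ∂angleMeasure =
      ∫ θ, Real.log ‖Real.cos θ • tangentImage f (unitTangentOf (x, 0)) +
        Real.sin θ • tangentImage f (unitTangentOf (x, Real.pi / 2))‖ ∂angleMeasure := by
  refine integral_congr_ae (Eventually.of_forall fun θ => ?_)
  beta_reduce
  rw [logStretchUnit, tangentImage_unitTangentOf]

theorem integral_logStretchUnit_pos {f : SphereDiffeo} (hf : MeasurePreserving f area area)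
    (hiso : ¬ Isometry f) : 0 < ∫ p, logStretchUnit f p ∂liouvilleUnit := by
  simp only [integral_logStretchUnit, integral_logStretchUnit_unitTangentOf]
  have hnonneg (x : S2) := integral_log_norm_cos_smul_add_sin_smul_nonneg (gram_tangentImage hf x)
  have hint := (integrable_logStretchUnit_unitTangentOf f).integral_prod_left
  simp only [integral_logStretchUnit_unitTangentOf] at hint
  refine (integral_nonneg hnonneg).lt_of_ne fun hzero => hiso ?_
  refine isometry_of_ae_norm_fderiv_homExt_eq ?_
  filter_upwards [(integral_eq_zero_iff_of_nonneg hnonneg hint).1 hzero.symm] with x hx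
  obtain ⟨hfst, hsnd, horth⟩ := norm_eq_one_of_integral_log_norm_eq_zero (gram_tangentImage hf x) hx
  exact norm_fderiv_homExt_eq_of_orthonormal hfst hsnd horth

/-! ### Integration over the projective bundle -/

theorem measurable_logStretch (f : SphereDiffeo) : Measurable (logStretch f) :=
  measurable_from_quotient.2 (continuous_logStretchUnit f).measurable

theorem integrable_logStretch (f : SphereDiffeo) : Integrable (logStretch f) liouville :=
  (integrable_map_measure (measurable_logStretch f).aestronglyMeasurable
    measurable_quotient_mk''.aemeasurable).2 (integrable_logStretchUnit f liouvilleUnit)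

theorem integral_logStretch (f : SphereDiffeo) :
    ∫ v, logStretch f v ∂liouville = ∫ p, logStretchUnit f p ∂liouvilleUnit :=
  integral_map measurable_quotient_mk''.aemeasurable (measurable_logStretch f).aestronglyMeasurable

end RandomSphere

end

theorem mainTheorem5_general (f : SphereDiffeo) :
    Integrable (logStretch f) liouville ∧
    HasRandomExponent (cosetMeasure f) (∫ v, logStretch f v ∂liouville) ∧
    (MeasurePreserving f area area → ¬ Isometry f → 0 < ∫ v, logStretch f v ∂liouville) := by
  rw [integral_logStretch]
  exact ⟨integrable_logStretch f, hasRandomExponent_cosetMeasure f, integral_logStretchUnit_pos⟩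

theorem mainTheorem5 (f : SphereDiffeo) (hf : MeasurePreserving f area area) :
    Integrable (logStretch f) liouville ∧
    ∃ R : ℝ, HasRandomExponent (cosetMeasure f) R ∧
      R = ∫ v, logStretch f v ∂liouville ∧
      (¬ Isometry f → 0 < R) := by
  obtain ⟨hint, hexp, hpos⟩ := mainTheorem5_general f
  exact ⟨hint, _, hexp, rfl, hpos hf⟩
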